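/- Let $X=\{X(t),t\in\mathbb R\}$ be a real-valued process on a probability space which is - $H$-self-similar: for all $c>0$, $\{X(ct)\}_{t\in\mathbb R}$ and $\{c^HX(t)\}_{t\in\mathbb R}$ have the same finite-dimensional distributions; - with stationary increments: for all $s\in\mathbb R$, $\{X(t+s)-X(s)\}_{t\in\mathbb R}$ and $\{X(t)-X(0)\}_{t\in\mathbb R}$ have the same finite-dimensional distributions; - symmetric $\alpha$-stable, $0<\alpha\le 2$: every finite linear combination $Z$ of values of $X$ satisfies $\mathbb E e^{i\theta Z}=e^{-\sigma^\alpha|\theta|^\alpha}$ $(\theta\in\mathbb R)$ for some $\sigma\ge 0$. Let $K\in\mathbb N$ and let $a_0,\dots,a_K\in\mathbb R$ satisfy $\sum_{k=0}^K a_k=0$ and $\sum_{k=0}^K k\,a_k=0$. Put $$\Delta_{p,n}X=\sum_{k=0}^K a_k X\Big(\frac{k+p}{n}\Big),\qquad V_n(\beta)=\frac1{n-K+1}\sum_{p=0}^{n-K}|\Delta_{p,n}X|^\beta,\qquad W_n(\beta)=n^{\beta H}V_n(\beta),$$ and assume that $\Delta_{0,1}X$ is not almost surely $0$. Let $-\frac12<\beta<0$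 and $-\frac12<\beta_1<\beta_2<0$. Define, for all large $n$, $$\widehat H_n=\frac1\beta\log_2\frac{V_{\lfloor n/2\rfloor}(\beta)}{V_n(\beta)},\qquad \widehat\alpha_n=\varphi_{-\beta_1,-\beta_2}\big(\psi_{-\beta_1,-\beta_2}(W_n(\beta_1),W_n(\beta_2))\big),$$ where for $0<v<u$ $(u<1)$ $$h_{u,v}(x)=u\ln\Gamma\Big(1+\frac vx\Big)-v\ln\Gamma\Big(1+\frac ux\Big)\quad(x>0),\qquad \psi_{u,v}(x,y)=-v\ln x+u\ln y+C(u,v),$$ $$C(u,v)=\tfrac{u-v}2\ln\pi+u\ln\Gamma(1+\tfrac v2)+v\ln\Gamma(\tfrac{1-u}2)-v\ln\Gamma(1+\tfrac u2)-u\ln\Gamma(\tfrac{1-v}2),$$ and $\varphi_{u,v}(x)=0$ for $x\ge 0$, $\varphi_{u,v}(x)=h_{u,v}^{-1}(x)$ for $x<0$, with $h_{u,v}^{-1}:(-\infty,0)\to(0,\infty)$ the inverse function of $h_{u,v}$. For $\gamma\in(-\frac12,0)$ put $S_n(\gamma)=\sum_{k\in\mathbb Z,\,|k|\le n}\big|\mathrm{cov}\big(|\Delta_{k,1}X|^\gamma,|\Delta_{0,1}X|^\gamma\big)\big|$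 and consider the conditions $$\text{(A}_\gamma)\quad \lim_{n\to\infty}\frac1n S_n(\gamma)=0;\qquad\qquad \text{(B}_{\gamma,b})\quad \limsup_{n\to\infty}\frac1{n\,b_n^2}S_n(\gamma)\le C^2\ \text{ for some constant } C,$$ the second one for a real sequence $b=(b_n)$ with $b_n\to0$ and $b_n\ne0$ for all large $n$. 1. If (A$_\beta$) holds, then $\widehat H_n\to H$ in probability. If (A$_{\beta_1}$) and (A$_{\beta_2}$) hold, then $\widehat\alpha_n\to\alpha$ in probability. 2. If (B$_{\beta,b}$) holds, then $\widehat H_n\to H$ in probability and $\widehat H_n-H=O_{\mathbb P}(b_n)$. If (B$_{\beta_1,b}$) and (B$_{\beta_2,b}$) hold, then $\widehat\alpha_n\to\alpha$ in probability and $\widehat\alpha_n-\alpha=O_{\mathbb P}(b_n)$. Here $Y_n=O_{\mathbb P}(b_n)$ means that $Y_n=b_nX_n$ for all large $n$, where for every $\varepsilon>0$ there is $M>0$ with $\sup_n\mathbb P(|X_n|>M)<\varepsilon$. -/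

import Mathlib

open MeasureTheory ProbabilityTheory Filter Topology

noncomputable section

/-! Self-similar stable processes with stationary increments -/

/-- Two real-valued processes indexed by the real line (on the same probability space) have the
same finite-dimensional distributions. -/
def SameFDD {Ω : Type*} [MeasurableSpace Ω] (P : Measure Ω) (X Y : ℝ → Ω → ℝ) : Prop :=
  ∀ (m : ℕ) (t : Fin m → ℝ),
    IdentDistrib (fun ω (i : Fin m) => X (t i) ω) (fun ω (i : Fin m) => Y (t i) ω) P P

/-- `H`-self-similarity: `{X(ct)}` and `c^H {X(t)}` have the same law for every `c > 0`. -/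
def IsSelfSimilar {Ω : Type*} [MeasurableSpace Ω] (P : Measure Ω) (H : ℝ) (X : ℝ → Ω → ℝ) :
    Prop :=
  ∀ c : ℝ, 0 < c → SameFDD P (fun t ω => X (c * t) ω) (fun t ω => c ^ H * X t ω)

/-- Stationary increments. -/
def HasStationaryIncr {Ω : Type*} [MeasurableSpace Ω] (P : Measure Ω) (X : ℝ → Ω → ℝ) : Prop :=
  ∀ s : ℝ, SameFDD P (fun t ω => X (t + s) ω - X s ω) (fun t ω => X t ω - X 0 ω)

/-- A (non-degenerate) symmetric `α`-stable random variable: for some scale `σ > 0` its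
characteristic function is `exp (-σ^α |θ|^α)`. -/
def IsSaS {Ω : Type*} [MeasurableSpace Ω] (P : Measure Ω) (α : ℝ) (Z : Ω → ℝ) : Prop :=
  ∃ σ : ℝ, 0 < σ ∧
    ∀ θ : ℝ, charFun (P.map Z) θ = ((Real.exp (-(σ ^ α * |θ| ^ α)) : ℝ) : ℂ)

/-- A symmetric `α`-stable process: every finite linear combination of its values is symmetric
`α`-stable, or degenerate (almost surely zero, i.e. of scale `σ = 0`). -/
def IsSaSProcess {Ω : Type*} [MeasurableSpace Ω] (P : Measure Ω) (α : ℝ) (X : ℝ → Ω → ℝ) :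
    Prop :=
  ∀ (m : ℕ) (t c : Fin m → ℝ),
    (∀ᵐ ω ∂P, ∑ i, c i * X (t i) ω = 0) ∨ IsSaS P α (fun ω => ∑ i, c i * X (t i) ω)

/-! Generalized increments, `β`-variations and the two estimators -/

/-- `Δ_{p,n} X = ∑_{k=0}^K a_k X((k+p)/n)`. -/
def genIncr {Ω : Type*} {K : ℕ} (a : Fin (K + 1) → ℝ) (X : ℝ → Ω → ℝ) (p : ℤ) (n : ℕ) (ω : Ω) :
    ℝ :=
  ∑ k : Fin (K + 1), a k * X ((((k : ℕ) : ℝ) + (p : ℝ)) / (n : ℝ)) ω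

/-- `V_n(β) = (n-K+1)⁻¹ ∑_{p=0}^{n-K} |Δ_{p,n} X|^β`; meaningful for `n ≥ K`
(the sum is empty if `n < K`). -/
def betaVar {Ω : Type*} {K : ℕ} (a : Fin (K + 1) → ℝ) (X : ℝ → Ω → ℝ) (β : ℝ) (n : ℕ) (ω : Ω) :
    ℝ :=
  1 / ((n : ℝ) - (K : ℝ) + 1) *
    ∑ p ∈ Finset.range (n + 1 - K), |genIncr a X (p : ℤ) n ω| ^ β

/-- `W_n(β) = n^{βH} V_n(β)`. -/
def normBetaVar {Ω : Type*} {K : ℕ} (a : Fin (K + 1) → ℝ) (X : ℝ → Ω → ℝ) (H β : ℝ) (n : ℕ)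
    (ω : Ω) : ℝ :=
  (n : ℝ) ^ (β * H) * betaVar a X β n ω

/-- `Ĥ_n = β⁻¹ log₂ (V_{n/2}(β) / V_n(β))`; for odd `n` the index `n/2` is rounded down. -/
def hurstEst {Ω : Type*} {K : ℕ} (a : Fin (K + 1) → ℝ) (X : ℝ → Ω → ℝ) (β : ℝ) (n : ℕ) (ω : Ω) :
    ℝ :=
  1 / β * Real.logb 2 (betaVar a X β (n / 2) ω / betaVar a X β n ω)

/-- `g_{u,v}(x) = u ln Γ(1+vx) - v ln Γ(1+ux)`. -/
def gFun (u v x : ℝ) : ℝ :=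
  u * Real.log (Real.Gamma (1 + v * x)) - v * Real.log (Real.Gamma (1 + u * x))

/-- `h_{u,v}(x) = g_{u,v}(1/x)`. -/
def hFun (u v x : ℝ) : ℝ := gFun u v (1 / x)

/-- The constant `C(u,v)`. -/
def cConst (u v : ℝ) : ℝ :=
  (u - v) / 2 * Real.log Real.pi
    + u * Real.log (Real.Gamma (1 + v / 2)) + v * Real.log (Real.Gamma ((1 - u) / 2))
    - v * Real.log (Real.Gamma (1 + u / 2)) - u * Real.log (Real.Gamma ((1 - v) / 2))

/-- `ψ_{u,v}(x,y) = -v ln x + u ln y + C(u,v)`. -/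
def psiFun (u v x y : ℝ) : ℝ := -v * Real.log x + u * Real.log y + cConst u v

open Classical in
/-- `φ_{u,v}(x) = 0` for `x ≥ 0`, and for `x < 0` it is the value at `x` of the inverse of
`h_{u,v} : (0,∞) → (-∞,0)` (a bijection when `0 < v < u`). -/
def phiFun (u v x : ℝ) : ℝ :=
  if 0 ≤ x then 0 else Function.invFunOn (hFun u v) (Set.Ioi 0) x

/-- `α̂_n = φ_{-β₁,-β₂} (ψ_{-β₁,-β₂} (W_n(β₁), W_n(β₂)))`. -/
def stableEst {Ω : Type*} {K : ℕ} (a : Fin (K + 1) → ℝ) (X : ℝ → Ω → ℝ) (H β₁ β₂ : ℝ) (n : ℕ)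
    (ω : Ω) : ℝ :=
  phiFun (-β₁) (-β₂)
    (psiFun (-β₁) (-β₂) (normBetaVar a X H β₁ n ω) (normBetaVar a X H β₂ n ω))

/-! The conditions on the covariances, and stochastic boundedness -/

/-- `∑_{k ∈ ℤ, |k| ≤ n} |cov(|Δ_{k,1} X|^β, |Δ_{0,1} X|^β)|`. -/
def absCovSum {Ω : Type*} [MeasurableSpace Ω] (P : Measure Ω) {K : ℕ} (a : Fin (K + 1) → ℝ)
    (X : ℝ → Ω → ℝ) (β : ℝ) (n : ℕ) : ℝ :=
  ∑ k ∈ Finset.Icc (-(n : ℤ)) (n : ℤ),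
    |covariance (fun ω => |genIncr a X k 1 ω| ^ β) (fun ω => |genIncr a X 0 1 ω| ^ β) P|

/-- The averaged absolute covariances tend to zero. -/
def AvgCovVanishes {Ω : Type*} [MeasurableSpace Ω] (P : Measure Ω) {K : ℕ} (a : Fin (K + 1) → ℝ)
    (X : ℝ → Ω → ℝ) (β : ℝ) : Prop :=
  Tendsto (fun n : ℕ => 1 / (n : ℝ) * absCovSum P a X β n) atTop (𝓝 0)

/-- The averaged absolute covariances are of order at most `b_n²`, where `b_n → 0`. The upper
limit is taken in the extended reals; `b_n` has to be nonzero for large `n` for the quotient to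
make sense. -/
def AvgCovRate {Ω : Type*} [MeasurableSpace Ω] (P : Measure Ω) {K : ℕ} (a : Fin (K + 1) → ℝ)
    (X : ℝ → Ω → ℝ) (β : ℝ) (b : ℕ → ℝ) : Prop :=
  Tendsto b atTop (𝓝 0) ∧ (∀ᶠ n in atTop, b n ≠ 0) ∧
    ∃ C : ℝ, limsup (fun n : ℕ => ((1 / ((n : ℝ) * b n ^ 2) * absCovSum P a X β n : ℝ) : EReal))
      atTop ≤ ((C ^ 2 : ℝ) : EReal)

/-- `X_n = O_P(1)`: for every `ε > 0` there is `M > 0` with `sup_n P(|X_n| > M) < ε`. -/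
def IsBoundedInProb {Ω : Type*} [MeasurableSpace Ω] (P : Measure Ω) (X : ℕ → Ω → ℝ) : Prop :=
  ∀ ε : ℝ, 0 < ε → ∃ M : ℝ, 0 < M ∧ (⨆ n, P {ω | M < |X n ω|}) < ENNReal.ofReal ε

/-- `Y_n = O_P(b_n)`: `Y_n = b_n X_n` with `X_n = O_P(1)`. The factorization is asked for all
large `n`, as `Y_n` may be meaningless, or `b_n` zero, for finitely many `n`. -/
def IsBigOInProb {Ω : Type*} [MeasurableSpace Ω] (P : Measure Ω) (Y : ℕ → Ω → ℝ) (b : ℕ → ℝ) :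
    Prop :=
  ∃ X : ℕ → Ω → ℝ, (∀ᶠ n in atTop, ∀ ω, Y n ω = b n * X n ω) ∧ IsBoundedInProb P X

end

open MeasureTheory ProbabilityTheory Filter Topology

noncomputable section

/-! By self-similarity `W_n(γ)` has the law of the average of `|Δ_{p,1} X|^γ` over `n-K+1` indices
(`identDistrib_normBetaVar`), and since `∑ a_k = 0` the variables `Δ_{p,1} X` form a stationary
sequence. The mean of this average is the stable moment `m_γ = sasMoment α σ γ`. As `2γ > -1`, its
variance is finite, and it is at most `S_n(γ)/(n-K+1)` (`variance_incrMean_le`). Chebyshev's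
inequality gives `W_n(γ) → m_γ` in probability under (A), with error `O_P(b_n)` under (B).

For `α̂_n`, the function `ψ` eliminates the unknown scale `σ`: its value at the two moments is
`h(α)` (`psiFun_sasMoment`). Log-convexity of `Γ` makes `h` strictly increasing with nonzero
derivative, so `φ` is differentiable at `h(α)`. Hence `φ ∘ ψ` is Lipschitz at the pair of moments,
and both consistency and rate carry over.

For `Ĥ_n`, `V_{n/2}/V_n = (W_{n/2}/W_n) (n/⌊n/2⌋)^{βH}`. The logarithm of the first factor is
Lipschitz at `(m_β, m_β)`. The second contributes `H` plus a rounding error `O(1/n)`, which is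
`O(b_n)` because `S_n(β)` is bounded below by the positive variance of `|Δ_{0,1} X|^β`. -/

/-! ### Negative absolute moments of symmetric stable laws -/

/-- The absolute moment of order `γ` of a symmetric `α`-stable law of scale `σ`. -/
def sasMoment (α σ γ : ℝ) : ℝ :=
  2 / α * Real.Gamma (-γ / α) / Real.Gamma (-γ / 2) * (2 * σ) ^ γ *
    (Real.Gamma ((1 + γ) / 2) / √Real.pi)

lemma sasMoment_pos {α σ γ : ℝ} (hα : 0 < α) (hσ : 0 < σ) (hγ : -1 < γ) (hγ0 : γ < 0) :
    0 < sasMoment α σ γ := by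
  have h1 : 0 < Real.Gamma (-γ / α) := Real.Gamma_pos_of_pos (div_pos (by linarith) hα)
  have h2 : 0 < Real.Gamma (-γ / 2) := Real.Gamma_pos_of_pos (by linarith)
  have h3 : 0 < Real.Gamma ((1 + γ) / 2) := Real.Gamma_pos_of_pos (by linarith)
  have := Real.pi_pos
  unfold sasMoment
  positivity

/-- Both sides are the double integral of `exp (i x y)`, which is bounded, so Fubini applies. -/
lemma integral_charFun_comm (μ ν : Measure ℝ) [IsFiniteMeasure μ] [IsFiniteMeasure ν] :
    ∫ x, charFun ν x ∂μ = ∫ y, charFun μ y ∂ν := by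
  simp_rw [charFun_apply_real]
  rw [integral_integral_swap]
  · refine integral_congr_ae (.of_forall fun y => integral_congr_ae (.of_forall fun x => ?_))
    simp only
    congr 1
    ring
  · refine (integrable_const (1 : ℝ)).mono' (Continuous.aestronglyMeasurable (by fun_prop))
      (.of_forall fun p => ?_)
    simp only [Function.uncurry]
    rw [← Complex.ofReal_mul, Complex.norm_exp_ofReal_mul_I]

/-- Gaussian randomization: the Laplace transform of `x²` as a Gaussian average of the
characteristic function. -/
lemma lintegral_exp_neg_mul_sq {μ : Measure ℝ} [IsProbabilityMeasure μ] {f : ℝ → ℝ}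
    (hf0 : ∀ θ, 0 ≤ f θ) (hf : ∀ θ, charFun μ θ = (f θ : ℂ)) {t : ℝ} (ht : 0 < t) :
    ∫⁻ x, ENNReal.ofReal (Real.exp (-(t * x ^ 2))) ∂μ =
      ∫⁻ y, ENNReal.ofReal (f (√(2 * t) * y)) ∂(gaussianReal 0 1) := by
  have hcont : Continuous f := by
    have h : f = fun θ => (charFun μ θ).re := by
      ext θ; rw [hf]; simp
    rw [h]
    exact Complex.continuous_re.comp (continuous_charFun)
  have hf1 : ∀ θ, f θ ≤ 1 := fun θ => by
    have := norm_charFun_le_one (μ := μ) θ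
    rw [hf, Complex.norm_real, Real.norm_eq_abs] at this
    exact (le_abs_self _).trans this
  have hint : ∀ (ν : Measure ℝ) [IsProbabilityMeasure ν], Integrable f ν := fun ν _ =>
    (integrable_const (1 : ℝ)).mono' hcont.aestronglyMeasurable
      (.of_forall fun x => by rw [Real.norm_eq_abs, abs_of_nonneg (hf0 x)]; exact hf1 x)
  -- Variance `2t` is chosen so that the Gaussian characteristic function at `x` is `exp (-t x²)`.
  have hmap : gaussianReal 0 (2 * t).toNNReal = (gaussianReal 0 1).map (√(2 * t) * ·) := by
    rw [gaussianReal_map_const_mul]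
    congr 1
    · simp
    · ext
      rw [mul_one, Real.coe_toNNReal _ (by positivity), NNReal.coe_mk,
        Real.sq_sqrt (by positivity)]
  have h1 : ∫ x, Real.exp (-(t * x ^ 2)) ∂μ = ∫ y, f y ∂(gaussianReal 0 (2 * t).toNNReal) := by
    have := integral_charFun_comm μ (gaussianReal 0 (2 * t).toNNReal)
    simp_rw [hf, charFun_gaussianReal] at this
    have h2 : ∀ x : ℝ, Complex.exp (x * (0 : ℝ) * Complex.I -
        ((2 * t).toNNReal : ℝ) * x ^ 2 / 2) = ((Real.exp (-(t * x ^ 2)) : ℝ) : ℂ) := by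
      intro x
      rw [Real.coe_toNNReal _ (by positivity)]
      push_cast
      congr 1
      ring
    simp_rw [h2] at this
    rw [integral_complex_ofReal, integral_complex_ofReal] at this
    exact_mod_cast this
  rw [← ofReal_integral_eq_lintegral_ofReal, h1, ofReal_integral_eq_lintegral_ofReal, hmap,
    lintegral_map]
  · fun_prop
  · fun_prop
  · exact hint _
  · exact .of_forall hf0
  · refine (integrable_const (1 : ℝ)).mono' (by fun_prop) (.of_forall fun x => ?_)
    rw [Real.norm_eq_abs, abs_of_pos (Real.exp_pos _), Real.exp_le_one_iff]
    have : 0 ≤ t * x ^ 2 := by positivity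
    linarith
  · exact .of_forall fun x => (Real.exp_pos _).le

lemma lintegral_Ioi_rpow_mul_exp_neg_mul_rpow {p q b : ℝ} (hp : 0 < p) (hq : -1 < q)
    (hb : 0 < b) :
    ∫⁻ t in Set.Ioi (0 : ℝ), ENNReal.ofReal (t ^ q * Real.exp (-(b * t ^ p))) =
      ENNReal.ofReal (b ^ (-(q + 1) / p) * (1 / p) * Real.Gamma ((q + 1) / p)) := by
  have h := integral_rpow_mul_exp_neg_mul_rpow hp hq hb
  simp_rw [neg_mul] at h
  rw [← h, ofReal_integral_eq_lintegral_ofReal]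
  -- A non-integrable function would have Bochner integral `0`, while this one is positive.
  · refine Integrable.of_integral_ne_zero ?_
    rw [h]
    have : 0 < Real.Gamma ((q + 1) / p) := Real.Gamma_pos_of_pos (div_pos (by linarith) hp)
    positivity
  · filter_upwards [ae_restrict_mem measurableSet_Ioi] with t ht
    have ht : 0 < t := ht
    positivity

lemma lintegral_abs_rpow_gaussianReal {γ : ℝ} (hγ : -1 < γ) :
    ∫⁻ y, ENNReal.ofReal (|y| ^ γ) ∂(gaussianReal 0 1) =
      ENNReal.ofReal (√2 ^ γ * (Real.Gamma ((1 + γ) / 2) / √Real.pi)) := by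
  have hm : Measurable fun y : ℝ => ENNReal.ofReal (|y| ^ γ) := by fun_prop
  have hpi := Real.pi_pos
  have hG : 0 < Real.Gamma ((γ + 1) / 2) := Real.Gamma_pos_of_pos (by linarith)
  have e : ∀ y : ℝ, gaussianPDFReal 0 1 y * |y| ^ γ =
      (√(2 * Real.pi))⁻¹ * (|y| ^ γ * Real.exp (-(1 / 2) * |y| ^ (2 : ℝ))) := by
    intro y
    simp [gaussianPDFReal]
    rw [mul_assoc, mul_comm (|y| ^ γ)]
    congr 3
    ring
  have hI : ∫ y : ℝ, gaussianPDFReal 0 1 y * |y| ^ γ =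
      √2 ^ γ * (Real.Gamma ((1 + γ) / 2) / √Real.pi) := by
    simp_rw [e]
    rw [integral_const_mul, integral_comp_abs
      (f := fun y => y ^ γ * Real.exp (-(1 / 2) * y ^ (2 : ℝ))),
      integral_rpow_mul_exp_neg_mul_rpow two_pos hγ (by norm_num)]
    rw [Real.sqrt_mul two_pos.le, add_comm γ 1, one_div, Real.inv_rpow two_pos.le,
      ← Real.rpow_neg two_pos.le]
    have : (2 : ℝ) ^ (-(-(1 + γ) / 2)) = √2 * √2 ^ γ := by
      rw [Real.sqrt_eq_rpow, ← Real.rpow_mul two_pos.le, ← Real.rpow_add two_pos]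
      congr 1
      ring
    rw [this]
    have : 0 < √2 := by positivity
    have : 0 < √Real.pi := by positivity
    field_simp
  rw [gaussianReal_of_var_ne_zero _ one_ne_zero,
    lintegral_withDensity_eq_lintegral_mul _ (measurable_gaussianPDF 0 1) hm, ← hI,
    ofReal_integral_eq_lintegral_ofReal]
  · refine lintegral_congr fun y => ?_
    rw [Pi.mul_apply, gaussianPDF, ENNReal.ofReal_mul (gaussianPDFReal_nonneg _ _ _)]
  · refine Integrable.of_integral_ne_zero ?_
    rw [hI, add_comm]
    positivity
  · exact .of_forall fun y => mul_nonneg (gaussianPDFReal_nonneg _ _ _) (by positivity)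

/-- The double integral defining the moment. -/
lemma lintegral_lintegral_exp_sas {μ : Measure ℝ} [IsProbabilityMeasure μ] {α σ γ : ℝ}
    (hα : 0 < α) (hσ : 0 < σ) (hγ : -1 < γ) (hγ0 : γ < 0)
    (hμ : ∀ θ, charFun μ θ = ((Real.exp (-(σ ^ α * |θ| ^ α)) : ℝ) : ℂ)) :
    ∫⁻ x, (∫⁻ t in Set.Ioi (0 : ℝ),
        ENNReal.ofReal (t ^ (-γ / 2 - 1) * Real.exp (-(x ^ 2 * t ^ (1 : ℝ))))) ∂μ =
      ENNReal.ofReal (Real.Gamma (-γ / 2) * sasMoment α σ γ) := by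
  -- For fixed `t`, the law `μ` is traded for a standard Gaussian one. Integrating in `t` first then
  -- leaves a multiple of the Gaussian moment of `|y|^γ`.
  have step : ∀ t ∈ Set.Ioi (0 : ℝ),
      ∫⁻ x, ENNReal.ofReal (t ^ (-γ / 2 - 1) * Real.exp (-(x ^ 2 * t ^ (1 : ℝ)))) ∂μ =
      ∫⁻ y, ENNReal.ofReal (t ^ (-γ / 2 - 1) *
        Real.exp (-((σ * √2 * |y|) ^ α * t ^ (α / 2)))) ∂(gaussianReal 0 1) := by
    intro t ht
    have ht : 0 < t := ht
    have h := lintegral_exp_neg_mul_sq (fun θ => (Real.exp_pos _).le) hμ ht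
    have h0 : 0 ≤ t ^ (-γ / 2 - 1) := by positivity
    simp_rw [ENNReal.ofReal_mul h0]
    rw [lintegral_const_mul _ (by fun_prop), lintegral_const_mul _ (by fun_prop)]
    congr 1
    simp_rw [Real.rpow_one, mul_comm _ t]
    rw [h]
    refine lintegral_congr fun y => ?_
    congr 3
    rw [abs_mul, abs_of_nonneg (Real.sqrt_nonneg _), ← Real.mul_rpow hσ.le (by positivity),
      Real.sqrt_mul two_pos.le, ← mul_assoc, ← mul_assoc, mul_right_comm (σ * √2),
      Real.mul_rpow (by positivity) (Real.sqrt_nonneg _), Real.sqrt_eq_rpow t,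
      ← Real.rpow_mul ht.le]
    congr 2
    ring
  rw [lintegral_lintegral_swap (Measurable.aemeasurable (by fun_prop)),
    setLIntegral_congr_fun measurableSet_Ioi step,
    lintegral_lintegral_swap (Measurable.aemeasurable (by fun_prop))]
  have hy0 : ∀ᵐ y ∂(gaussianReal 0 1), y ≠ 0 := by
    have := nullSingletonClass_gaussianReal (μ := 0) (one_ne_zero (α := NNReal))
    exact (measure_eq_zero_iff_ae_notMem).1 (measure_singleton (0 : ℝ))
  have inner : ∀ᵐ y ∂(gaussianReal 0 1),
      ∫⁻ t in Set.Ioi (0 : ℝ), ENNReal.ofReal (t ^ (-γ / 2 - 1) *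
        Real.exp (-((σ * √2 * |y|) ^ α * t ^ (α / 2)))) =
      ENNReal.ofReal ((σ * √2) ^ γ * (2 / α) * Real.Gamma (-γ / α)) *
        ENNReal.ofReal (|y| ^ γ) := by
    filter_upwards [hy0] with y hy
    have hy : 0 < |y| := abs_pos.2 hy
    rw [lintegral_Ioi_rpow_mul_exp_neg_mul_rpow (by positivity) (by linarith) (by positivity),
      ← ENNReal.ofReal_mul' (by positivity), ← Real.rpow_mul (by positivity),
      Real.mul_rpow (by positivity) hy.le]
    have e1 : α * (-(-γ / 2 - 1 + 1) / (α / 2)) = γ := by field_simp; ring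
    have e2 : (-γ / 2 - 1 + 1) / (α / 2) = -γ / α := by field_simp; ring
    rw [e1, e2]
    congr 1
    rw [one_div_div]
    ring
  rw [lintegral_congr_ae inner, lintegral_const_mul _ (by fun_prop),
    lintegral_abs_rpow_gaussianReal hγ, ← ENNReal.ofReal_mul]
  · congr 1
    have h2 : Real.Gamma (-γ / 2) ≠ 0 := (Real.Gamma_pos_of_pos (by linarith)).ne'
    have h22 : (2 * σ) ^ γ = σ ^ γ * √2 ^ γ * √2 ^ γ := by
      rw [mul_assoc, ← Real.mul_rpow (Real.sqrt_nonneg _) (Real.sqrt_nonneg _),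
        Real.mul_self_sqrt two_pos.le, ← Real.mul_rpow hσ.le two_pos.le, mul_comm]
    rw [sasMoment, h22, Real.mul_rpow hσ.le (Real.sqrt_nonneg _),
      div_mul_eq_mul_div, div_mul_eq_mul_div, mul_div_cancel₀ _ h2]
    ring
  · have : 0 < Real.Gamma (-γ / α) := Real.Gamma_pos_of_pos (div_pos (by linarith) hα)
    positivity

/-- At `x = 0` the inner integral is that of a pure power over `(0,∞)`, which diverges; as the
double integral is finite, `0` is not an atom. Any `γ` in `(-1,0)` would serve. -/
lemma ae_ne_zero_of_sas {μ : Measure ℝ} [IsProbabilityMeasure μ] {α σ : ℝ}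
    (hα : 0 < α) (hσ : 0 < σ)
    (hμ : ∀ θ, charFun μ θ = ((Real.exp (-(σ ^ α * |θ| ^ α)) : ℝ) : ℂ)) : ∀ᵐ x ∂μ, x ≠ 0 := by
  have h := lintegral_lintegral_exp_sas hα hσ (γ := -(1 / 2)) (by norm_num) (by norm_num) hμ
  have h2 := ae_lt_top' (μ := μ) (AEMeasurable.lintegral_prod_right'
    (f := fun p : ℝ × ℝ => ENNReal.ofReal (p.2 ^ (-(-(1 / 2) : ℝ) / 2 - 1) *
      Real.exp (-(p.1 ^ 2 * p.2 ^ (1 : ℝ)))))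
    (Measurable.aemeasurable (by fun_prop))) (by rw [h]; exact ENNReal.ofReal_ne_top)
  filter_upwards [h2] with x hx hx0
  subst hx0
  refine not_integrableOn_Ioi_rpow (-(-(1 / 2) : ℝ) / 2 - 1) ⟨?_, ?_⟩
  · exact Measurable.aestronglyMeasurable (by fun_prop)
  · rw [hasFiniteIntegral_iff_ofReal]
    · simpa using hx
    · filter_upwards [ae_restrict_mem measurableSet_Ioi] with t ht
      have ht : 0 < t := ht
      positivity

lemma lintegral_abs_rpow_sas {μ : Measure ℝ} [IsProbabilityMeasure μ] {α σ γ : ℝ}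
    (hα : 0 < α) (hσ : 0 < σ) (hγ : -1 < γ) (hγ0 : γ < 0)
    (hμ : ∀ θ, charFun μ θ = ((Real.exp (-(σ ^ α * |θ| ^ α)) : ℝ) : ℂ)) :
    ∫⁻ x, ENNReal.ofReal (|x| ^ γ) ∂μ = ENNReal.ofReal (sasMoment α σ γ) := by
  have h := lintegral_lintegral_exp_sas hα hσ hγ hγ0 hμ
  have hG : 0 < Real.Gamma (-γ / 2) := Real.Gamma_pos_of_pos (by linarith)
  -- This fails at `x = 0`, where the left side is infinite and `|0| ^ γ` is `0` by convention;
  -- hence the need for the absence of an atom.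
  have inner : ∀ᵐ x ∂μ, ∫⁻ t in Set.Ioi (0 : ℝ),
        ENNReal.ofReal (t ^ (-γ / 2 - 1) * Real.exp (-(x ^ 2 * t ^ (1 : ℝ)))) =
      ENNReal.ofReal (Real.Gamma (-γ / 2)) * ENNReal.ofReal (|x| ^ γ) := by
    filter_upwards [ae_ne_zero_of_sas hα hσ hμ] with x hx
    have hx : 0 < |x| := abs_pos.2 hx
    rw [← sq_abs, lintegral_Ioi_rpow_mul_exp_neg_mul_rpow one_pos (by linarith) (by positivity),
      ← ENNReal.ofReal_mul hG.le, ← Real.rpow_natCast, ← Real.rpow_mul hx.le]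
    congr 1
    have e1 : ((2 : ℕ) : ℝ) * (-(-γ / 2 - 1 + 1) / 1) = γ := by push_cast; ring
    have e2 : (-γ / 2 - 1 + 1) / 1 = -γ / 2 := by ring
    rw [e1, e2]
    ring
  rw [lintegral_congr_ae inner, lintegral_const_mul _ (by fun_prop), ENNReal.ofReal_mul hG.le] at h
  exact (ENNReal.mul_right_inj (by simpa using hG) ENNReal.ofReal_ne_top).1 h

lemma integrable_abs_rpow_sas {μ : Measure ℝ} [IsProbabilityMeasure μ] {α σ γ : ℝ}
    (hα : 0 < α) (hσ : 0 < σ) (hγ : -1 < γ) (hγ0 : γ < 0)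
    (hμ : ∀ θ, charFun μ θ = ((Real.exp (-(σ ^ α * |θ| ^ α)) : ℝ) : ℂ)) :
    Integrable (fun x => |x| ^ γ) μ := by
  refine ⟨Measurable.aestronglyMeasurable (by fun_prop), ?_⟩
  rw [hasFiniteIntegral_iff_ofReal (.of_forall fun x => by positivity),
    lintegral_abs_rpow_sas hα hσ hγ hγ0 hμ]
  exact ENNReal.ofReal_lt_top

lemma integral_abs_rpow_sas {μ : Measure ℝ} [IsProbabilityMeasure μ] {α σ γ : ℝ}
    (hα : 0 < α) (hσ : 0 < σ) (hγ : -1 < γ) (hγ0 : γ < 0)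
    (hμ : ∀ θ, charFun μ θ = ((Real.exp (-(σ ^ α * |θ| ^ α)) : ℝ) : ℂ)) :
    ∫ x, |x| ^ γ ∂μ = sasMoment α σ γ := by
  rw [integral_eq_lintegral_of_nonneg_ae (.of_forall fun x => by positivity)
    (Measurable.aestronglyMeasurable (by fun_prop)), lintegral_abs_rpow_sas hα hσ hγ hγ0 hμ,
    ENNReal.toReal_ofReal (sasMoment_pos hα hσ hγ hγ0).le]

/-- The square is the moment of order `2γ`, which is why `γ > -1/2` is required. -/
lemma memLp_two_abs_rpow_sas {μ : Measure ℝ} [IsProbabilityMeasure μ] {α σ γ : ℝ}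
    (hα : 0 < α) (hσ : 0 < σ) (hγ : -(1 / 2) < γ) (hγ0 : γ < 0)
    (hμ : ∀ θ, charFun μ θ = ((Real.exp (-(σ ^ α * |θ| ^ α)) : ℝ) : ℂ)) :
    MemLp (fun x => |x| ^ γ) 2 μ := by
  rw [memLp_two_iff_integrable_sq (Measurable.aestronglyMeasurable (by fun_prop))]
  refine (integrable_abs_rpow_sas hα hσ (γ := 2 * γ) (by linarith) (by linarith) hμ).congr
    (.of_forall fun x => ?_)
  simp only
  rw [mul_comm, Real.rpow_mul (abs_nonneg _)]
  norm_cast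

/-- The absolute value of a symmetric stable variable is not almost surely constant. -/
lemma not_ae_abs_eq_const_of_sas {μ : Measure ℝ} [IsProbabilityMeasure μ] {α σ : ℝ}
    (hα : 0 < α) (hσ : 0 < σ)
    (hμ : ∀ θ, charFun μ θ = ((Real.exp (-(σ ^ α * |θ| ^ α)) : ℝ) : ℂ)) (c : ℝ) :
    ¬ ∀ᵐ x ∂μ, |x| = c := by
  intro hc
  have hc0 : 0 < c := by
    obtain ⟨x, hx, hx0⟩ := (hc.and (ae_ne_zero_of_sas hα hσ hμ)).exists
    rw [← hx]
    exact abs_pos.2 hx0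
  -- If `|x| = c` almost surely, then `exp (iπx/c) = -1`, whereas a stable characteristic function
  -- is positive.
  have h1 : (charFun μ (Real.pi / c)).re = -1 := by
    rw [charFun_apply_real]
    have : ∀ᵐ x : ℝ ∂μ, Complex.exp (((Real.pi / c : ℝ) : ℂ) * x * Complex.I) = ((-1 : ℝ) : ℂ) := by
      filter_upwards [hc] with x hx
      rcases eq_or_eq_neg_of_abs_eq hx with rfl | rfl
      · have : ((Real.pi / x : ℝ) : ℂ) * x = Real.pi := by
          norm_cast; field_simp
        rw [this, Complex.exp_pi_mul_I]; simp
      · have : ((Real.pi / c : ℝ) : ℂ) * (-c : ℝ) = -Real.pi := by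
          norm_cast; field_simp
        rw [this, neg_mul, Complex.exp_neg, Complex.exp_pi_mul_I]; norm_num
    rw [integral_congr_ae this]
    simp
  rw [hμ, Complex.ofReal_re] at h1
  linarith [Real.exp_pos (-(σ ^ α * |Real.pi / c| ^ α))]

/-! ### Monotonicity of `h_{u,v}` and regularity of its inverse -/

lemma differentiableAt_log_Gamma {x : ℝ} (hx : 0 < x) :
    DifferentiableAt ℝ (fun y => Real.log (Real.Gamma y)) x := by
  refine (Real.differentiableAt_Gamma ?_).log (Real.Gamma_ne_zero ?_) <;>
  exact fun m => ne_of_gt (by have : (0 : ℝ) ≤ m := m.cast_nonneg; linarith)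

lemma deriv_log_Gamma_add_one {x : ℝ} (hx : 0 < x) :
    deriv (fun y => Real.log (Real.Gamma y)) (x + 1) =
      deriv (fun y => Real.log (Real.Gamma y)) x + x⁻¹ := by
  rw [← deriv_comp_add_const, ← Real.deriv_log,
    ← deriv_add (differentiableAt_log_Gamma hx) (Real.differentiableAt_log hx.ne')]
  apply EventuallyEq.deriv_eq
  filter_upwards [eventually_gt_nhds hx] with y hy
  rw [Pi.add_apply, Real.Gamma_add_one hy.ne',
    Real.log_mul hy.ne' (Real.Gamma_pos_of_pos hy).ne', add_comm]

/-- Convexity gives only weak monotonicity. Applied at `x+1` and `y+1`, it becomes strict at `x` and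
`y` because the recurrence subtracts the strictly decreasing `1/x`. -/
lemma strictMonoOn_deriv_log_Gamma :
    StrictMonoOn (deriv fun y => Real.log (Real.Gamma y)) (Set.Ioi 0) := by
  intro x hx y hy hxy
  have hx : 0 < x := hx
  have hy : 0 < y := hy
  have hmono : MonotoneOn (deriv fun y => Real.log (Real.Gamma y)) (Set.Ioi 0) :=
    ConvexOn.monotoneOn_deriv Real.convexOn_log_Gamma fun x hx => differentiableAt_log_Gamma hx
  have h := hmono (show x + 1 ∈ Set.Ioi (0 : ℝ) from add_pos hx one_pos)
    (show y + 1 ∈ Set.Ioi (0 : ℝ) from add_pos hy one_pos) (by linarith)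
  rw [deriv_log_Gamma_add_one hx, deriv_log_Gamma_add_one hy] at h
  have : y⁻¹ < x⁻¹ := by gcongr
  linarith

lemma hasDerivAt_gFun {u v x : ℝ} (hu : 0 < u) (hv : 0 < v) (hx : 0 ≤ x) :
    HasDerivAt (gFun u v)
      (u * v * (deriv (fun y => Real.log (Real.Gamma y)) (1 + v * x) -
        deriv (fun y => Real.log (Real.Gamma y)) (1 + u * x))) x := by
  have h : ∀ w : ℝ, 0 < w → HasDerivAt (fun x => Real.log (Real.Gamma (1 + w * x)))
      (deriv (fun y => Real.log (Real.Gamma y)) (1 + w * x) * w) x := by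
    intro w hw
    have h1 : HasDerivAt (fun x => 1 + w * x) w x := by
      simpa using ((hasDerivAt_id x).const_mul w).const_add 1
    exact (differentiableAt_log_Gamma (by positivity : 0 < 1 + w * x)).hasDerivAt.comp x h1
  convert! ((h v hv).const_mul u).sub ((h u hu).const_mul v) using 1
  ring

lemma deriv_gFun_neg {u v x : ℝ} (hv : 0 < v) (hvu : v < u) (hx : 0 < x) :
    u * v * (deriv (fun y => Real.log (Real.Gamma y)) (1 + v * x) -
        deriv (fun y => Real.log (Real.Gamma y)) (1 + u * x)) < 0 := by
  have hu := hv.trans hvu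
  refine mul_neg_of_pos_of_neg (by positivity) (sub_neg.2 ?_)
  exact strictMonoOn_deriv_log_Gamma (by simp only [Set.mem_Ioi]; positivity)
    (by simp only [Set.mem_Ioi]; positivity) (by gcongr)

lemma strictAntiOn_gFun {u v : ℝ} (hv : 0 < v) (hvu : v < u) :
    StrictAntiOn (gFun u v) (Set.Ici 0) := by
  have hu := hv.trans hvu
  refine strictAntiOn_of_deriv_neg (convex_Ici 0)
    (fun x hx => (hasDerivAt_gFun hu hv hx).continuousAt.continuousWithinAt) fun x hx => ?_
  rw [interior_Ici] at hx
  rw [(hasDerivAt_gFun hu hv (le_of_lt hx)).deriv]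
  exact deriv_gFun_neg hv hvu hx

/-- `g_{u,v}` vanishes at `0`, as `Γ(1) = 1`, and strictly decreases from there. -/
lemma hFun_neg {u v x : ℝ} (hv : 0 < v) (hvu : v < u) (hx : 0 < x) : hFun u v x < 0 := by
  have h := strictAntiOn_gFun hv hvu (Set.mem_Ici.2 le_rfl)
    (Set.mem_Ici.2 (one_div_pos.2 hx).le) (one_div_pos.2 hx)
  simpa [gFun, hFun] using h

lemma strictMonoOn_hFun {u v : ℝ} (hv : 0 < v) (hvu : v < u) :
    StrictMonoOn (hFun u v) (Set.Ioi 0) := by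
  intro x hx y hy hxy
  exact strictAntiOn_gFun hv hvu (Set.mem_Ici.2 (one_div_pos.2 hy).le)
    (Set.mem_Ici.2 (one_div_pos.2 hx).le) (one_div_lt_one_div_of_lt hx hxy)

lemma exists_hasDerivAt_hFun {u v x : ℝ} (hv : 0 < v) (hvu : v < u) (hx : 0 < x) :
    ∃ c ≠ 0, HasDerivAt (hFun u v) c x := by
  have hx' : 0 < x⁻¹ := inv_pos.2 hx
  have h := (hasDerivAt_gFun (hv.trans hvu) hv hx'.le).comp x (hasDerivAt_inv hx.ne')
  refine ⟨_, mul_ne_zero (deriv_gFun_neg hv hvu hx').ne ?_, h.congr_of_eventuallyEq ?_⟩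
  · simp [hx.ne']
  · exact .of_forall fun y => by simp [hFun]

/-- Injectivity of `h` suffices. Surjectivity onto `(-∞,0)` is avoided, since `φ` is studied only
near a value of `h`, where the intermediate value theorem provides preimages. -/
lemma phiFun_hFun {u v x : ℝ} (hv : 0 < v) (hvu : v < u) (hx : 0 < x) :
    phiFun u v (hFun u v x) = x := by
  rw [phiFun, if_neg (not_le.2 (hFun_neg hv hvu hx))]
  exact (strictMonoOn_hFun hv hvu).injOn.leftInvOn_invFunOn hx

/-- Near a value of `h_{u,v}`, the points are values at points nearby. -/
lemma eventually_mem_image_hFun {u v a r s : ℝ} (hv : 0 < v) (hvu : v < u) (hr : 0 < r)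
    (hra : r < a) (has : a < s) :
    ∀ᶠ y in 𝓝 (hFun u v a), y ∈ hFun u v '' Set.Ioo r s := by
  have hmono := strictMonoOn_hFun hv hvu
  have ha : 0 < a := hr.trans hra
  have hs : 0 < s := ha.trans has
  have hc : ContinuousOn (hFun u v) (Set.Icc r s) := fun x hx => by
    obtain ⟨c, -, h⟩ := exists_hasDerivAt_hFun hv hvu (hr.trans_le hx.1)
    exact h.continuousAt.continuousWithinAt
  filter_upwards [Ioo_mem_nhds (hmono hr ha hra) (hmono ha hs has)] with y hy
  exact intermediate_value_Ioo (hra.trans has).le hc hy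

lemma continuousAt_phiFun {u v a : ℝ} (hv : 0 < v) (hvu : v < u) (ha : 0 < a) :
    ContinuousAt (phiFun u v) (hFun u v a) := by
  rw [ContinuousAt, phiFun_hFun hv hvu ha, tendsto_order]
  constructor
  · intro r hr
    -- The maximum with `a / 2` keeps the preimages positive even if `r ≤ 0`.
    have h := eventually_mem_image_hFun hv hvu (r := max r (a / 2)) (lt_max_of_lt_right (by linarith))
      (max_lt hr (by linarith)) (lt_add_one a)
    filter_upwards [h] with y hy
    obtain ⟨x, hx, rfl⟩ := hy
    have := max_lt_iff.1 hx.1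
    rw [phiFun_hFun hv hvu (by linarith)]
    exact this.1
  · intro s hs
    have h := eventually_mem_image_hFun hv hvu (r := a / 2) (by linarith) (by linarith) hs
    filter_upwards [h] with y hy
    obtain ⟨x, hx, rfl⟩ := hy
    have := hx.1
    rw [phiFun_hFun hv hvu (by linarith)]
    exact hx.2

lemma differentiableAt_phiFun {u v a : ℝ} (hv : 0 < v) (hvu : v < u) (ha : 0 < a) :
    DifferentiableAt ℝ (phiFun u v) (hFun u v a) := by
  obtain ⟨c, hc, h⟩ := exists_hasDerivAt_hFun hv hvu ha
  refine (HasDerivAt.of_local_left_inverse (continuousAt_phiFun hv hvu ha) (f := hFun u v)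
    (f' := c) (by rwa [phiFun_hFun hv hvu ha]) hc ?_).differentiableAt
  have h2 := eventually_mem_image_hFun hv hvu (r := a / 2) (by linarith) (by linarith)
    (lt_add_one a)
  filter_upwards [h2] with y hy
  obtain ⟨x, hx, rfl⟩ := hy
  have := hx.1
  rw [phiFun_hFun hv hvu (by linarith)]

/-! ### The moments under `ψ`, and local Lipschitz bounds -/

lemma log_sasMoment {α σ w : ℝ} (hα : 0 < α) (hσ : 0 < σ) (hw0 : 0 < w) (hw : w < 1) :
    Real.log (sasMoment α σ (-w)) = Real.log (Real.Gamma (1 + w * (1 / α))) -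
      Real.log (Real.Gamma (1 + w / 2)) - w * Real.log (2 * σ) +
      Real.log (Real.Gamma ((1 - w) / 2)) - Real.log Real.pi / 2 := by
  have h1 : 0 < Real.Gamma (w / α) := Real.Gamma_pos_of_pos (by positivity)
  have h2 : 0 < Real.Gamma (w / 2) := Real.Gamma_pos_of_pos (by positivity)
  have h3 : 0 < Real.Gamma ((1 - w) / 2) := Real.Gamma_pos_of_pos (by linarith)
  have hpi : 0 < √Real.pi := Real.sqrt_pos.2 Real.pi_pos
  -- The factor `2/α` is split so that `Γ(z+1) = zΓ(z)` absorbs it in both Gamma values.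
  have e : sasMoment α σ (-w) = (w / α * Real.Gamma (w / α)) / (w / 2 * Real.Gamma (w / 2)) *
      (2 * σ) ^ (-w) * (Real.Gamma ((1 - w) / 2) / √Real.pi) := by
    rw [sasMoment, neg_neg, ← sub_eq_add_neg]
    field_simp
  have hp : 0 < (2 * σ) ^ (-w) := by positivity
  rw [e, ← Real.Gamma_add_one (by positivity), ← Real.Gamma_add_one (by positivity),
    mul_one_div, add_comm (w / α), add_comm (w / 2)]
  have h4 : 0 < Real.Gamma (1 + w / α) := Real.Gamma_pos_of_pos (by positivity)
  have h5 : 0 < Real.Gamma (1 + w / 2) := Real.Gamma_pos_of_pos (by positivity)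
  rw [Real.log_mul (by positivity) (by positivity), Real.log_mul (by positivity) (by positivity),
    Real.log_div h4.ne' h5.ne', Real.log_div h3.ne' hpi.ne', Real.log_rpow (by positivity),
    Real.log_sqrt Real.pi_pos.le]
  ring

/-- The terms `w log (2σ)` cancel in the combination with weights `-v` and `u`, and `C(u,v)` removes
every other term free of `α`. -/
lemma psiFun_sasMoment {α σ u v : ℝ} (hα : 0 < α) (hσ : 0 < σ) (hu0 : 0 < u) (hu : u < 1)
    (hv0 : 0 < v) (hv : v < 1) :
    psiFun u v (sasMoment α σ (-u)) (sasMoment α σ (-v)) = hFun u v α := by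
  rw [psiFun, cConst, hFun, gFun, log_sasMoment hα hσ hu0 hu, log_sasMoment hα hσ hv0 hv]
  ring

/-- A function of two variables is Lipschitz at a point of differentiability. -/
lemma exists_abs_sub_le_of_differentiableAt {F : ℝ × ℝ → ℝ} {x₀ y₀ : ℝ}
    (hF : DifferentiableAt ℝ F (x₀, y₀)) :
    ∃ L > 0, ∃ δ > 0, ∀ x y, |x - x₀| < δ → |y - y₀| < δ →
      |F (x, y) - F (x₀, y₀)| ≤ L * (|x - x₀| + |y - y₀|) := by
  obtain ⟨L, hL, h⟩ := hF.isBigO_sub.exists_pos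
  rw [Asymptotics.IsBigOWith, Metric.eventually_nhds_iff] at h
  obtain ⟨δ, hδ, h⟩ := h
  refine ⟨L, hL, δ, hδ, fun x y hx hy => ?_⟩
  have h2 := @h (x, y) (by rw [Prod.dist_eq, max_lt_iff]; exact ⟨hx, hy⟩)
  refine h2.trans (mul_le_mul_of_nonneg_left ?_ hL.le)
  rw [Prod.norm_def]
  exact max_le (le_add_of_nonneg_right (abs_nonneg _)) (le_add_of_nonneg_left (abs_nonneg _))

lemma exists_abs_phiFun_psiFun_sub_le {α σ u v : ℝ} (hα : 0 < α) (hσ : 0 < σ)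
    (hv : 0 < v) (hvu : v < u) (hu : u < 1) :
    ∃ L > 0, ∃ δ > 0, ∀ x y, |x - sasMoment α σ (-u)| < δ → |y - sasMoment α σ (-v)| < δ →
      |phiFun u v (psiFun u v x y) - α| ≤
        L * (|x - sasMoment α σ (-u)| + |y - sasMoment α σ (-v)|) := by
  have hx := (sasMoment_pos hα hσ (γ := -u) (by linarith) (by linarith)).ne'
  have hy := (sasMoment_pos hα hσ (γ := -v) (by linarith) (by linarith)).ne'
  have hval := psiFun_sasMoment hα hσ (hv.trans hvu) hu hv (hvu.trans hu)
  have hψ : DifferentiableAt ℝ (fun p : ℝ × ℝ => psiFun u v p.1 p.2)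
      (sasMoment α σ (-u), sasMoment α σ (-v)) := by
    unfold psiFun
    fun_prop (disch := assumption)
  have hφ := differentiableAt_phiFun hv hvu hα
  rw [← hval] at hφ
  obtain ⟨L, hL, δ, hδ, h⟩ := exists_abs_sub_le_of_differentiableAt
    (F := fun p => phiFun u v (psiFun u v p.1 p.2)) (x₀ := sasMoment α σ (-u))
    (y₀ := sasMoment α σ (-v))
    (DifferentiableAt.comp (g := phiFun u v) (f := fun p : ℝ × ℝ => psiFun u v p.1 p.2) _ hφ hψ)
  simp only [hval, phiFun_hFun hv hvu hα] at h
  exact ⟨L, hL, δ, hδ, h⟩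

lemma exists_abs_logb_div_le {m : ℝ} (hm : 0 < m) :
    ∃ L > 0, ∃ δ > 0, ∀ x y, |x - m| < δ → |y - m| < δ →
      |Real.logb 2 (x / y)| ≤ L * (|x - m| + |y - m|) := by
  have hF : DifferentiableAt ℝ (fun p : ℝ × ℝ => Real.logb 2 (p.1 / p.2)) (m, m) := by
    simp_rw [Real.logb, div_eq_mul_inv]
    have h1 : DifferentiableAt ℝ (fun p : ℝ × ℝ => p.1 * p.2⁻¹) (m, m) :=
      differentiableAt_fst.mul (differentiableAt_snd.inv hm.ne')
    exact (h1.log (by simp [hm.ne'])).mul_const _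
  obtain ⟨L, hL, δ, hδ, h⟩ := exists_abs_sub_le_of_differentiableAt hF
  simp only [div_self hm.ne', Real.logb_one, sub_zero] at h
  exact ⟨L, hL, δ, hδ, h⟩

/-! ### Stationarity, self-similarity and the variance bound -/

lemma genIncr_one {Ω : Type*} {X : ℝ → Ω → ℝ} {K : ℕ} {a : Fin (K + 1) → ℝ} (p : ℤ)
    (ω : Ω) : genIncr a X p 1 ω = ∑ k : Fin (K + 1), a k * X (((k : ℕ) : ℝ) + (p : ℝ)) ω := by
  simp [genIncr]

/-- Since the weights sum to zero, any base value `X s` may be subtracted; this brings stationary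
increments into play. -/
lemma genIncr_eq_sub {Ω : Type*} {X : ℝ → Ω → ℝ} {K : ℕ} {a : Fin (K + 1) → ℝ}
    (ha0 : ∑ k, a k = 0) (p : ℤ) (s : ℝ) (ω : Ω) :
    genIncr a X p 1 ω = ∑ k : Fin (K + 1), a k * (X (((k : ℕ) : ℝ) + (p : ℝ)) ω - X s ω) := by
  simp_rw [genIncr_one, mul_sub, Finset.sum_sub_distrib, ← Finset.sum_mul, ha0]
  simp

section Increments

variable {Ω : Type*} [MeasurableSpace Ω] {P : Measure Ω} {X : ℝ → Ω → ℝ} {K : ℕ}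
  {a : Fin (K + 1) → ℝ}

/-- Arbitrary finite index types allow disjoint unions for pairs of increments and products for
whole families of them. -/
lemma SameFDD.identDistrib {Y : ℝ → Ω → ℝ} (h : SameFDD P X Y) {ι : Type*} [Fintype ι]
    (t : ι → ℝ) : IdentDistrib (fun ω i => X (t i) ω) (fun ω i => Y (t i) ω) P P := by
  have e := Fintype.equivFin ι
  have h1 := (h _ (t ∘ e.symm)).comp (u := fun x i => x (e i)) (by fun_prop)
  simpa [Function.comp_def] using h1

lemma measurable_genIncr (hX : ∀ t, Measurable (X t)) (p : ℤ) (n : ℕ) :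
    Measurable (genIncr a X p n) := by
  unfold genIncr
  fun_prop

/-- Pairs of generalized increments are stationary. -/
lemma identDistrib_genIncr_pair (hsi : HasStationaryIncr P X) (ha0 : ∑ k, a k = 0)
    (p q s : ℤ) :
    IdentDistrib (fun ω => (genIncr a X (p + s) 1 ω, genIncr a X (q + s) 1 ω))
      (fun ω => (genIncr a X p 1 ω, genIncr a X q 1 ω)) P P := by
  have h := ((hsi s).identDistrib (ι := Fin (K + 1) ⊕ Fin (K + 1))
    (Sum.elim (fun k => ((k : ℕ) : ℝ) + p) (fun k => ((k : ℕ) : ℝ) + q))).comp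
    (u := fun x => (∑ k, a k * x (Sum.inl k), ∑ k, a k * x (Sum.inr k))) (by fun_prop)
  convert h using 1
  · ext ω
    · simp [genIncr_eq_sub ha0 (p + s) s, add_assoc]
    · simp [genIncr_eq_sub ha0 (q + s) s, add_assoc]
  · ext ω
    · simp [genIncr_eq_sub ha0 p 0]
    · simp [genIncr_eq_sub ha0 q 0]

lemma identDistrib_genIncr (hsi : HasStationaryIncr P X) (ha0 : ∑ k, a k = 0) (p : ℤ) :
    IdentDistrib (genIncr a X p 1) (genIncr a X 0 1) P P := by
  have h := (identDistrib_genIncr_pair hsi ha0 0 0 p).comp measurable_fst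
  simpa [Function.comp_def] using h

lemma covariance_eq_of_identDistrib_pair {U V U' V' : Ω → ℝ}
    (h : IdentDistrib (fun ω => (U ω, V ω)) (fun ω => (U' ω, V' ω)) P P) :
    cov[U, V; P] = cov[U', V'; P] := by
  have h1 := covariance_map (μ := P) (X := Prod.fst) (Y := Prod.snd)
    measurable_fst.aestronglyMeasurable measurable_snd.aestronglyMeasurable h.aemeasurable_fst
  have h2 := covariance_map (μ := P) (X := Prod.fst) (Y := Prod.snd)
    measurable_fst.aestronglyMeasurable measurable_snd.aestronglyMeasurable h.aemeasurable_snd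
  rw [h.map_eq] at h1
  exact h1.symm.trans h2

lemma covariance_genIncr (hsi : HasStationaryIncr P X) (ha0 : ∑ k, a k = 0) (γ : ℝ) (p q : ℤ) :
    cov[fun ω => |genIncr a X p 1 ω| ^ γ, fun ω => |genIncr a X q 1 ω| ^ γ; P] =
      cov[fun ω => |genIncr a X (p - q) 1 ω| ^ γ, fun ω => |genIncr a X 0 1 ω| ^ γ; P] := by
  have h := (identDistrib_genIncr_pair hsi ha0 (p - q) 0 q).comp
    (u := fun x : ℝ × ℝ => (|x.1| ^ γ, |x.2| ^ γ)) (by fun_prop)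
  simp only [sub_add_cancel, zero_add] at h
  exact covariance_eq_of_identDistrib_pair h

/-- The average of `|Δ_{p,1} X|^γ`, which has the law of `W_n(γ)`. -/
def incrMean (a : Fin (K + 1) → ℝ) (X : ℝ → Ω → ℝ) (γ : ℝ) (n : ℕ) (ω : Ω) : ℝ :=
  1 / ((n : ℝ) - (K : ℝ) + 1) * ∑ p ∈ Finset.range (n + 1 - K), |genIncr a X (p : ℤ) 1 ω| ^ γ

/-- Self-similarity with `c = 1/n`, jointly in all sample points, extracts `n^{-H}` from each
increment, and `n^{γH}` compensates its `γ`-th power. -/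
lemma identDistrib_normBetaVar {H : ℝ} (hss : IsSelfSimilar P H X) (γ : ℝ) {n : ℕ}
    (hn : 0 < n) :
    IdentDistrib (normBetaVar a X H γ n) (incrMean a X γ n) P P := by
  have hn' : (0 : ℝ) < n := by exact_mod_cast hn
  have h := ((hss (1 / n) (by positivity)).identDistrib (ι := Fin (n + 1 - K) × Fin (K + 1))
    (fun i => ((i.2 : ℕ) : ℝ) + ((i.1 : ℕ) : ℝ))).comp
    (u := fun x => (n : ℝ) ^ (γ * H) * (1 / ((n : ℝ) - (K : ℝ) + 1) *
      ∑ p, |∑ k, a k * x (p, k)| ^ γ)) (by fun_prop)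
  convert h using 1
  · ext ω
    simp only [normBetaVar, betaVar, genIncr, Finset.sum_range, Function.comp_apply]
    congr 4 with p
    congr 3 with k
    congr 2
    push_cast
    ring
  · ext ω
    simp only [incrMean, genIncr_one, Finset.sum_range, Function.comp_apply]
    have key : ∀ x : ℝ, (n : ℝ) ^ (γ * H) * |(1 / (n : ℝ)) ^ H * x| ^ γ = |x| ^ γ := by
      intro x
      rw [abs_mul, Real.mul_rpow (abs_nonneg _) (abs_nonneg _), ← mul_assoc,
        abs_of_nonneg (by positivity : 0 ≤ (1 / (n : ℝ)) ^ H), ← Real.rpow_mul (by positivity),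
        mul_comm H γ, ← Real.mul_rpow hn'.le (by positivity), mul_one_div_cancel hn'.ne',
        Real.one_rpow, one_mul]
    have key_sum : ∀ x : Fin (n + 1 - K) → ℝ,
        (n : ℝ) ^ (γ * H) * ∑ p, |(1 / (n : ℝ)) ^ H * x p| ^ γ = ∑ p, |x p| ^ γ := by
      intro x
      rw [Finset.mul_sum]
      simp_rw [key]
    simp_rw [mul_left_comm (a _) ((1 / (n : ℝ)) ^ H), ← Finset.mul_sum,
      mul_left_comm ((n : ℝ) ^ (γ * H)), key_sum]
    simp

lemma isSaS_genIncr {α : ℝ} (hstable : IsSaSProcess P α X)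
    (hnd : ¬ ∀ᵐ ω ∂P, genIncr a X 0 1 ω = 0) : IsSaS P α (genIncr a X 0 1) := by
  have h := hstable (K + 1) (fun k => ((k : ℕ) : ℝ)) a
  have e : (fun ω => ∑ k : Fin (K + 1), a k * X ((k : ℕ) : ℝ) ω) = genIncr a X 0 1 := by
    ext ω; simp [genIncr]
  rw [e] at h
  exact h.resolve_left fun h => hnd (h.mono fun ω hω => (congrFun e ω).symm.trans hω)

lemma absCovSum_nonneg (γ : ℝ) (n : ℕ) : 0 ≤ absCovSum P a X γ n :=
  Finset.sum_nonneg fun _ _ => abs_nonneg _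

lemma absCovSum_mono (γ : ℝ) : Monotone (absCovSum P a X γ) := fun n n' h =>
  Finset.sum_le_sum_of_subset_of_nonneg (Finset.Icc_subset_Icc (by omega) (by omega))
    fun _ _ _ => abs_nonneg _

/-- The variance is the term `k = 0` of the sum. -/
lemma variance_le_absCovSum {γ : ℝ}
    (hL : ∀ p : ℤ, MemLp (fun ω => |genIncr a X p 1 ω| ^ γ) 2 P) (n : ℕ) :
    Var[fun ω => |genIncr a X 0 1 ω| ^ γ; P] ≤ absCovSum P a X γ n := by
  rw [← covariance_self (hL 0).1.aemeasurable]
  exact (le_abs_self _).trans (Finset.single_le_sum (f := fun k : ℤ =>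
    |cov[fun ω => |genIncr a X k 1 ω| ^ γ, fun ω => |genIncr a X 0 1 ω| ^ γ; P]|)
    (fun _ _ => abs_nonneg _) (Finset.mem_Icc.2 ⟨by omega, by omega⟩))

lemma memLp_incrMean {γ : ℝ} (hL : ∀ p : ℤ, MemLp (fun ω => |genIncr a X p 1 ω| ^ γ) 2 P)
    (n : ℕ) : MemLp (incrMean a X γ n) 2 P :=
  (memLp_finsetSum (Finset.range (n + 1 - K)) fun (p : ℕ) _ => hL p).const_mul _

variable [IsProbabilityMeasure P]

lemma memLp_genIncr (hX : ∀ t, Measurable (X t)) (hsi : HasStationaryIncr P X)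
    (ha0 : ∑ k, a k = 0) {α σ γ : ℝ} (hα : 0 < α) (hσ : 0 < σ)
    (hγ : -(1 / 2) < γ) (hγ0 : γ < 0) (hZ : ∀ θ, charFun (P.map (genIncr a X 0 1)) θ =
      ((Real.exp (-(σ ^ α * |θ| ^ α)) : ℝ) : ℂ)) (p : ℤ) :
    MemLp (fun ω => |genIncr a X p 1 ω| ^ γ) 2 P := by
  have hm := measurable_genIncr (a := a) hX 0 1
  have := Measure.isProbabilityMeasure_map (μ := P) hm.aemeasurable
  have h0 : MemLp (fun ω => |genIncr a X 0 1 ω| ^ γ) 2 P :=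
    (memLp_two_abs_rpow_sas hα hσ hγ hγ0 hZ).comp_of_map hm.aemeasurable
  exact ((identDistrib_genIncr hsi ha0 p).comp (u := fun x => |x| ^ γ)
    (by fun_prop)).symm.memLp_snd h0

lemma integral_genIncr (hX : ∀ t, Measurable (X t)) (hsi : HasStationaryIncr P X)
    (ha0 : ∑ k, a k = 0) {α σ γ : ℝ} (hα : 0 < α) (hσ : 0 < σ)
    (hγ : -1 < γ) (hγ0 : γ < 0) (hZ : ∀ θ, charFun (P.map (genIncr a X 0 1)) θ =
      ((Real.exp (-(σ ^ α * |θ| ^ α)) : ℝ) : ℂ)) (p : ℤ) :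
    ∫ ω, |genIncr a X p 1 ω| ^ γ ∂P = sasMoment α σ γ := by
  have hm := measurable_genIncr (a := a) hX 0 1
  have := Measure.isProbabilityMeasure_map (μ := P) hm.aemeasurable
  rw [← integral_abs_rpow_sas hα hσ hγ hγ0 hZ, integral_map hm.aemeasurable
    (Measurable.aestronglyMeasurable (by fun_prop))]
  exact ((identDistrib_genIncr hsi ha0 p).comp (u := fun x => |x| ^ γ)
    (by fun_prop)).integral_eq

/-- In each row `p`, the differences `p - q` are distinct integers of `[-n, n]`. -/
lemma sum_range_sum_range_sub_le (f : ℤ → ℝ) (hf : ∀ k, 0 ≤ f k) {N n : ℕ} (hN : N ≤ n + 1) :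
    ∑ p ∈ Finset.range N, ∑ q ∈ Finset.range N, f ((p : ℤ) - q) ≤
      N * ∑ k ∈ Finset.Icc (-(n : ℤ)) n, f k := by
  have h := Finset.sum_le_card_nsmul (Finset.range N)
    (fun p => ∑ q ∈ Finset.range N, f ((p : ℤ) - q)) (∑ k ∈ Finset.Icc (-(n : ℤ)) n, f k)
  rw [nsmul_eq_mul, Finset.card_range] at h
  apply h
  intro p hp
  have hp := Finset.mem_range.1 hp
  rw [← Finset.sum_image (f := f) (g := fun q : ℕ => (p : ℤ) - q) (by intro x _ y _ h; simpa using h)]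
  refine Finset.sum_le_sum_of_subset_of_nonneg (fun k hk => ?_) fun _ _ _ => hf _
  obtain ⟨q, hq, rfl⟩ := Finset.mem_image.1 hk
  have hq := Finset.mem_range.1 hq
  rw [Finset.mem_Icc]
  omega

lemma variance_incrMean_le (hsi : HasStationaryIncr P X) (ha0 : ∑ k, a k = 0) {γ : ℝ}
    (hL : ∀ p : ℤ, MemLp (fun ω => |genIncr a X p 1 ω| ^ γ) 2 P) {n : ℕ} (hn : K ≤ n) :
    Var[incrMean a X γ n; P] ≤ absCovSum P a X γ n / ((n : ℝ) - K + 1) := by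
  have hN : (n : ℝ) - K + 1 = ((n + 1 - K : ℕ) : ℝ) := by
    rw [Nat.cast_sub (by omega)]; push_cast; ring
  have hN0 : (0 : ℝ) < ((n + 1 - K : ℕ) : ℝ) := by exact_mod_cast (by omega : 0 < n + 1 - K)
  unfold incrMean
  rw [variance_const_mul, variance_fun_sum' fun (p : ℕ) _ => hL p, hN]
  have h : ∑ p ∈ Finset.range (n + 1 - K), ∑ q ∈ Finset.range (n + 1 - K),
      cov[fun ω => |genIncr a X (p : ℤ) 1 ω| ^ γ, fun ω => |genIncr a X (q : ℤ) 1 ω| ^ γ; P] ≤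
      ((n + 1 - K : ℕ) : ℝ) * absCovSum P a X γ n := by
    refine le_trans ?_ (sum_range_sum_range_sub_le _ (fun k => abs_nonneg _) (by omega))
    refine Finset.sum_le_sum fun p _ => Finset.sum_le_sum fun q _ => ?_
    rw [covariance_genIncr hsi ha0]
    exact le_abs_self _
  calc _ ≤ (1 / ((n + 1 - K : ℕ) : ℝ)) ^ 2 * (((n + 1 - K : ℕ) : ℝ) * absCovSum P a X γ n) :=
        mul_le_mul_of_nonneg_left h (by positivity)
    _ = _ := by field_simp

lemma integral_incrMean {γ m : ℝ}
    (hL : ∀ p : ℤ, MemLp (fun ω => |genIncr a X p 1 ω| ^ γ) 2 P)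
    (hm : ∀ p : ℤ, ∫ ω, |genIncr a X p 1 ω| ^ γ ∂P = m) {n : ℕ} (hn : K ≤ n) :
    ∫ ω, incrMean a X γ n ω ∂P = m := by
  have hN : (n : ℝ) - K + 1 = ((n + 1 - K : ℕ) : ℝ) := by
    rw [Nat.cast_sub (by omega)]; push_cast; ring
  have hN0 : (0 : ℝ) < ((n + 1 - K : ℕ) : ℝ) := by exact_mod_cast (by omega : 0 < n + 1 - K)
  unfold incrMean
  rw [integral_const_mul, integral_finsetSum _ fun (p : ℕ) _ => (hL p).integrable one_le_two, hN]
  simp [hm]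
  field_simp

/-- Chebyshev's inequality for `W_n(γ)`. -/
lemma measure_le_abs_normBetaVar_sub {H : ℝ} (hss : IsSelfSimilar P H X)
    (hsi : HasStationaryIncr P X) (ha0 : ∑ k, a k = 0) {γ m : ℝ}
    (hL : ∀ p : ℤ, MemLp (fun ω => |genIncr a X p 1 ω| ^ γ) 2 P)
    (hm : ∀ p : ℤ, ∫ ω, |genIncr a X p 1 ω| ^ γ ∂P = m) {n : ℕ} (hn0 : 0 < n) (hn : K ≤ n)
    {r : ℝ} (hr : 0 < r) :
    P {ω | r ≤ |normBetaVar a X H γ n ω - m|} ≤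
      ENNReal.ofReal (absCovSum P a X γ n / ((n : ℝ) - K + 1) / r ^ 2) := by
  have h1 := (identDistrib_normBetaVar (a := a) hss γ hn0).measure_mem_eq
    (s := {x | r ≤ |x - m|}) (measurableSet_le measurable_const (by fun_prop))
  have h2 := meas_ge_le_variance_div_sq (memLp_incrMean hL n) hr
  rw [integral_incrMean hL hm hn] at h2
  refine (h1.le.trans h2).trans (ENNReal.ofReal_le_ofReal ?_)
  exact div_le_div_of_nonneg_right (variance_incrMean_le hsi ha0 hL hn) (by positivity)

/-- Zero variance would make `|Δ_{0,1} X|^γ`, hence `|Δ_{0,1} X|`, almost surely constant. -/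
lemma variance_genIncr_pos (hX : ∀ t, Measurable (X t))
    {α σ γ : ℝ} (hα : 0 < α) (hσ : 0 < σ)
    (hγ0 : γ < 0) (hZ : ∀ θ, charFun (P.map (genIncr a X 0 1)) θ =
      ((Real.exp (-(σ ^ α * |θ| ^ α)) : ℝ) : ℂ))
    (hL : MemLp (fun ω => |genIncr a X 0 1 ω| ^ γ) 2 P) :
    0 < Var[fun ω => |genIncr a X 0 1 ω| ^ γ; P] := by
  have hm := measurable_genIncr (a := a) hX 0 1
  have := Measure.isProbabilityMeasure_map (μ := P) hm.aemeasurable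
  refine (variance_nonneg _ _).lt_of_ne fun h => ?_
  have h1 := ae_eq_integral_of_variance_eq_zero hL h.symm
  set m := ∫ ω, |genIncr a X 0 1 ω| ^ γ ∂P
  refine not_ae_abs_eq_const_of_sas hα hσ hZ (m ^ γ⁻¹) ?_
  rw [ae_map_iff hm.aemeasurable (measurableSet_eq_fun (by fun_prop) (by fun_prop))]
  filter_upwards [h1] with ω hω
  rw [← hω, Real.rpow_rpow_inv (abs_nonneg _) hγ0.ne]

end Increments

/-! ### Measurability of `φ`, and transfer of Chebyshev bounds to estimators -/

/-- Stochastic boundedness takes a supremum over all `n`, so each single estimator has to be tight,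
which is derived from measurability. -/
lemma measurable_phiFun {u v : ℝ} (hv : 0 < v) (hvu : v < u) : Measurable (phiFun u v) := by
  have himage : ∀ r, 0 ≤ r → MeasurableSet (hFun u v '' Set.Ioi r) := fun r hr => by
    refine (isPreconnected_Ioi.image _ fun x hx => ?_).ordConnected.measurableSet
    obtain ⟨c, -, h⟩ := exists_hasDerivAt_hFun hv hvu (hr.trans_lt hx)
    exact h.continuousAt.continuousWithinAt
  refine Measurable.ite measurableSet_Ici measurable_const (measurable_of_Ioi fun c => ?_)
  -- Off the range of `h`, `invFunOn` takes one default value, so the complement of the range lies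
  -- in the preimage entirely or not at all.
  have e : Function.invFunOn (hFun u v) (Set.Ioi 0) ⁻¹' Set.Ioi c =
      hFun u v '' Set.Ioi (max c 0) ∪
        ((hFun u v '' Set.Ioi 0)ᶜ ∩ {_x : ℝ | c < Classical.choice (inferInstance : Nonempty ℝ)}) := by
    ext x
    by_cases hx : x ∈ hFun u v '' Set.Ioi 0
    · obtain ⟨t, ht, rfl⟩ := hx
      have h1 := (strictMonoOn_hFun hv hvu).injOn.leftInvOn_invFunOn ht
      have ht' : 0 < t := ht
      simp only [Set.mem_preimage, h1, Set.mem_union, Set.mem_inter_iff, Set.mem_compl_iff,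
        Set.mem_image_of_mem _ ht, not_true_eq_false, false_and, or_false, Set.mem_Ioi]
      constructor
      · exact fun h => ⟨t, max_lt h ht', rfl⟩
      · rintro ⟨s, hs, hst⟩
        have hs' := max_lt_iff.1 (Set.mem_Ioi.1 hs)
        rw [← (strictMonoOn_hFun hv hvu).injOn hs'.2 ht hst]
        exact hs'.1
    · have h1 : x ∉ hFun u v '' Set.Ioi (max c 0) := fun h =>
        hx (Set.image_mono (Set.Ioi_subset_Ioi (le_max_right _ _)) h)
      simp [h1, hx, Function.invFunOn_neg hx]
  rw [e]
  exact (himage _ (le_max_right _ _)).union ((himage 0 le_rfl).compl.inter (.const _))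

section Probability

variable {Ω : Type*} [MeasurableSpace Ω] {P : Measure Ω}

/-- Convergence in probability of a function of two estimators. -/
lemma tendstoInMeasure_of_abs_sub_le {A B F : ℕ → Ω → ℝ} {x₀ y₀ c L δ : ℝ} {s d : ℕ → ℝ}
    (hL : 0 < L) (hδ : 0 < δ)
    (hA : ∀ᶠ n in atTop, ∀ r > 0, P {ω | r ≤ |A n ω - x₀|} ≤ ENNReal.ofReal (s n / r ^ 2))
    (hB : ∀ᶠ n in atTop, ∀ r > 0, P {ω | r ≤ |B n ω - y₀|} ≤ ENNReal.ofReal (s n / r ^ 2))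
    (hs : Tendsto s atTop (𝓝 0)) (hd : Tendsto d atTop (𝓝 0))
    (hF : ∀ᶠ n in atTop, ∀ ω, |A n ω - x₀| < δ → |B n ω - y₀| < δ →
      |F n ω - c| ≤ L * (|A n ω - x₀| + |B n ω - y₀|) + d n) :
    TendstoInMeasure P F atTop (fun _ => c) := by
  rw [tendstoInMeasure_iff_norm]
  intro ε hε
  -- With this `η` the Lipschitz part stays within `ε/2`, and `d n < ε/2` eventually.
  set η := min δ (ε / (4 * L)) with hη
  have hη0 : 0 < η := lt_min hδ (by positivity)
  have hηL : L * η ≤ ε / 4 := by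
    calc L * η ≤ L * (ε / (4 * L)) := by gcongr; exact min_le_right _ _
      _ = ε / 4 := by field_simp
  have hlim : Tendsto (fun n => ENNReal.ofReal (s n / η ^ 2) + ENNReal.ofReal (s n / η ^ 2)) atTop
      (𝓝 0) := by
    have h1 : Tendsto (fun n => ENNReal.ofReal (s n / η ^ 2)) atTop (𝓝 0) := by
      simpa using ENNReal.tendsto_ofReal (hs.div_const (η ^ 2))
    simpa using h1.add h1
  refine tendsto_of_tendsto_of_tendsto_of_le_of_le' tendsto_const_nhds hlim
    (.of_forall fun _ => zero_le) ?_
  filter_upwards [hA, hB, hF, hd.eventually_lt_const (half_pos hε)] with n hA hB hF hd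
  refine (measure_mono fun ω hω => ?_).trans ((measure_union_le _ _).trans
    (add_le_add (hA η hη0) (hB η hη0)))
  by_contra! h
  simp only [Set.mem_union, Set.mem_ofPred_eq, not_or, not_le] at h
  have h1 := hF ω (h.1.trans_le (min_le_left _ _)) (h.2.trans_le (min_le_left _ _))
  have h2 : L * (|A n ω - x₀| + |B n ω - y₀|) ≤ L * (η + η) := by
    gcongr
    exacts [h.1.le, h.2.le]
  have h3 : ε ≤ |F n ω - c| := hω
  linarith

variable [IsProbabilityMeasure P]

/-- A single random variable is tight. -/
lemma exists_measure_lt_abs_le {f : Ω → ℝ} (hf : Measurable f) {ε : ℝ} (hε : 0 < ε) :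
    ∃ M : ℝ, 0 ≤ M ∧ P {ω | M < |f ω|} ≤ ENNReal.ofReal ε := by
  have h := tendsto_measure_iInter_atTop (μ := P) (s := fun n : ℕ => {ω | (n : ℝ) < |f ω|})
    (fun n => (measurableSet_lt measurable_const (by fun_prop)).nullMeasurableSet)
    (fun n n' hn ω (hω : (n' : ℝ) < _) => lt_of_le_of_lt (by exact_mod_cast hn) hω)
    ⟨0, measure_ne_top _ _⟩
  have e : ⋂ n : ℕ, {ω | (n : ℝ) < |f ω|} = ∅ := by
    ext ω
    simp only [Set.mem_iInter, Set.mem_ofPred_eq, Set.mem_empty_iff_false, iff_false, not_forall,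
      not_lt]
    exact exists_nat_ge _
  rw [e, measure_empty] at h
  obtain ⟨n, hn⟩ := (h.eventually_le_const (ENNReal.ofReal_pos.2 hε)).exists
  exact ⟨n, n.cast_nonneg, hn⟩

lemma isBoundedInProb_of_eventually {Y : ℕ → Ω → ℝ} (hY : ∀ n, Measurable (Y n))
    (h : ∀ ε : ℝ, 0 < ε → ∃ M : ℝ, 0 < M ∧
      ∀ᶠ n in atTop, P {ω | M < |Y n ω|} ≤ ENNReal.ofReal ε) :
    IsBoundedInProb P Y := by
  intro ε hε
  obtain ⟨M, hM, h⟩ := h (ε / 2) (half_pos hε)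
  obtain ⟨N, hN⟩ := eventually_atTop.1 h
  choose f hf0 hf using fun n => exists_measure_lt_abs_le (P := P) (hY n) (half_pos hε)
  have hsum : 0 ≤ ∑ n ∈ Finset.range N, f n := Finset.sum_nonneg fun _ _ => hf0 _
  -- The sum dominates the individual bounds of the first `N` variables; `ε / 2` leaves room for the
  -- strict inequality on the supremum.
  refine ⟨M + ∑ n ∈ Finset.range N, f n, by positivity, lt_of_le_of_lt (iSup_le fun n => ?_)
    ((ENNReal.ofReal_lt_ofReal_iff hε).2 (half_lt_self hε))⟩
  have hmono : ∀ M₁ M₂ : ℝ, M₁ ≤ M₂ → P {ω | M₂ < |Y n ω|} ≤ P {ω | M₁ < |Y n ω|} :=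
    fun M₁ M₂ h => measure_mono fun ω (hω : M₂ < |Y n ω|) => lt_of_le_of_lt h hω
  rcases le_or_gt N n with hn | hn
  · exact (hmono _ _ (by linarith)).trans (hN n hn)
  · have := Finset.single_le_sum (f := f) (fun _ _ => hf0 _) (Finset.mem_range.2 hn)
    exact (hmono _ _ (by linarith)).trans (hf n)

lemma isBigOInProb_of_eventually {Y : ℕ → Ω → ℝ} {b : ℕ → ℝ} (hY : ∀ n, Measurable (Y n))
    (hb : ∀ᶠ n in atTop, b n ≠ 0)
    (h : ∀ ε : ℝ, 0 < ε → ∃ M : ℝ, 0 < M ∧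
      ∀ᶠ n in atTop, P {ω | M * |b n| < |Y n ω|} ≤ ENNReal.ofReal ε) :
    IsBigOInProb P Y b := by
  refine ⟨fun n ω => Y n ω / b n, hb.mono fun n hn ω => (mul_div_cancel₀ _ hn).symm,
    isBoundedInProb_of_eventually (fun n => (hY n).div_const _) fun ε hε => ?_⟩
  obtain ⟨M, hM, h⟩ := h ε hε
  refine ⟨M, hM, ?_⟩
  filter_upwards [h, hb] with n hn hbn
  refine le_trans (le_of_eq ?_) hn
  congr 1 with ω
  rw [Set.mem_ofPred_eq, Set.mem_ofPred_eq, abs_div, lt_div_iff₀ (abs_pos.2 hbn)]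

/-- Rate of convergence in probability of a function of two estimators. -/
lemma isBigOInProb_of_abs_sub_le {A B F : ℕ → Ω → ℝ} {x₀ y₀ c L δ q D : ℝ} {b d : ℕ → ℝ}
    (hL : 0 < L) (hδ : 0 < δ) (hq : 0 < q) (hD : 0 ≤ D) (hFm : ∀ n, Measurable (F n))
    (hA : ∀ᶠ n in atTop, ∀ r > 0,
      P {ω | r ≤ |A n ω - x₀|} ≤ ENNReal.ofReal (q * b n ^ 2 / r ^ 2))
    (hB : ∀ᶠ n in atTop, ∀ r > 0,
      P {ω | r ≤ |B n ω - y₀|} ≤ ENNReal.ofReal (q * b n ^ 2 / r ^ 2))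
    (hb : Tendsto b atTop (𝓝 0)) (hb0 : ∀ᶠ n in atTop, b n ≠ 0)
    (hd : ∀ᶠ n in atTop, d n ≤ D * |b n|)
    (hF : ∀ᶠ n in atTop, ∀ ω, |A n ω - x₀| < δ → |B n ω - y₀| < δ →
      |F n ω - c| ≤ L * (|A n ω - x₀| + |B n ω - y₀|) + d n) :
    IsBigOInProb P (fun n ω => F n ω - c) b := by
  refine isBigOInProb_of_eventually (fun n => (hFm n).sub_const _) hb0 fun ε hε => ?_
  -- Chebyshev at radius `M |b n|` then gives each of the two estimators probability at most `ε/2`.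
  set M := √(2 * q / ε) with hM
  have hM0 : 0 < M := Real.sqrt_pos.2 (by positivity)
  have hM2 : q / M ^ 2 = ε / 2 := by
    rw [hM, Real.sq_sqrt (by positivity)]
    field_simp
  refine ⟨2 * L * M + D, by positivity, ?_⟩
  have hbδ : ∀ᶠ n in atTop, M * |b n| < δ := by
    have : Tendsto (fun n => M * |b n|) atTop (𝓝 0) := by simpa using hb.abs.const_mul M
    exact this.eventually_lt_const hδ
  filter_upwards [hA, hB, hF, hd, hb0, hbδ] with n hA hB hF hd hb0 hbδ
  have hbn : 0 < |b n| := abs_pos.2 hb0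
  have hr : 0 < M * |b n| := by positivity
  have e : q * b n ^ 2 / (M * |b n|) ^ 2 = ε / 2 := by
    rw [mul_pow, sq_abs, mul_div_mul_right _ _ (pow_ne_zero 2 hb0), hM2]
  have hA := hA _ hr
  have hB := hB _ hr
  rw [e] at hA hB
  rw [← add_halves ε, ENNReal.ofReal_add (by positivity) (by positivity)]
  refine (measure_mono fun ω hω => ?_).trans ((measure_union_le _ _).trans (add_le_add hA hB))
  by_contra! h
  simp only [Set.mem_union, Set.mem_ofPred_eq, not_or, not_le] at h
  have h1 := hF ω (h.1.trans hbδ) (h.2.trans hbδ)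
  have h2 : L * (|A n ω - x₀| + |B n ω - y₀|) ≤ L * (M * |b n| + M * |b n|) := by
    gcongr
    exacts [h.1.le, h.2.le]
  have h3 : (2 * L * M + D) * |b n| < |F n ω - c| := hω
  linarith

end Probability

/-! ### The Hurst estimator and the rounding of `n/2` -/

lemma abs_logb_div_half_sub_one_le {n : ℕ} (hn : 2 ≤ n) :
    |Real.logb 2 ((n : ℝ) / ((n / 2 : ℕ) : ℝ)) - 1| ≤ 4 * (1 / (n : ℝ)) := by
  have hl : 1 ≤ n / 2 := by omega
  have h1 : (1 : ℝ) ≤ ((n / 2 : ℕ) : ℝ) := by exact_mod_cast hl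
  have h2 : 2 * ((n / 2 : ℕ) : ℝ) ≤ n := by exact_mod_cast (by omega : 2 * (n / 2) ≤ n)
  have h3 : (n : ℝ) ≤ 2 * ((n / 2 : ℕ) : ℝ) + 1 := by exact_mod_cast (by omega : n ≤ 2 * (n / 2) + 1)
  set l : ℝ := ((n / 2 : ℕ) : ℝ)
  have hn0 : (0 : ℝ) < n := by linarith
  have hl0 : 0 < l := by linarith
  have hlog : 1 / 2 < Real.log 2 := by linarith [Real.log_two_gt_d9]
  have e : Real.logb 2 ((n : ℝ) / l) - 1 = Real.log (n / (2 * l)) / Real.log 2 := by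
    rw [Real.logb, mul_comm, ← div_div, Real.log_div (by positivity) two_ne_zero, sub_div,
      div_self (by linarith)]
  have h4 : 0 ≤ Real.log (n / (2 * l)) :=
    Real.log_nonneg ((one_le_div₀ (by positivity)).2 h2)
  -- `n/(2l) - 1 ≤ 1/(2l)` and `n ≤ 4l`. Division by `log 2 > 1/2` then yields the constant `4`.
  have h5 : Real.log (n / (2 * l)) ≤ 2 / n := by
    refine (Real.log_le_sub_one_of_pos (by positivity)).trans ?_
    rw [div_sub_one (by positivity), div_le_div_iff₀ (by positivity) hn0]
    nlinarith
  rw [e, abs_of_nonneg (div_nonneg h4 (by linarith)), div_le_iff₀ (by linarith)]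
  calc _ ≤ 2 / (n : ℝ) := h5
    _ = 4 * (1 / (n : ℝ)) * (1 / 2) := by ring
    _ ≤ _ := by gcongr

lemma hurstEst_sub_eq {Ω : Type*} {X : ℝ → Ω → ℝ} {K : ℕ} {a : Fin (K + 1) → ℝ} {H β : ℝ}
    (hβ : β ≠ 0) {n : ℕ} (hn : 2 ≤ n) {ω : Ω}
    (h1 : 0 < normBetaVar a X H β (n / 2) ω) (h2 : 0 < normBetaVar a X H β n ω) :
    hurstEst a X β n ω - H = 1 / β *
      Real.logb 2 (normBetaVar a X H β (n / 2) ω / normBetaVar a X H β n ω) +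
      H * (Real.logb 2 ((n : ℝ) / ((n / 2 : ℕ) : ℝ)) - 1) := by
  have hl0 : (0 : ℝ) < ((n / 2 : ℕ) : ℝ) := by exact_mod_cast (by omega : 0 < n / 2)
  have hn0 : (0 : ℝ) < n := by exact_mod_cast (by omega : 0 < n)
  unfold normBetaVar at *
  have p1 : (0 : ℝ) < ((n / 2 : ℕ) : ℝ) ^ (β * H) := by positivity
  have p2 : (0 : ℝ) < (n : ℝ) ^ (β * H) := by positivity
  have v1 := (pos_iff_pos_of_mul_pos h1).1 p1
  have v2 := (pos_iff_pos_of_mul_pos h2).1 p2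
  rw [hurstEst, Real.logb_div v1.ne' v2.ne', Real.logb_div h1.ne' h2.ne',
    Real.logb_mul p1.ne' v1.ne', Real.logb_mul p2.ne' v2.ne', Real.logb_rpow_eq_mul_logb_of_pos hl0,
    Real.logb_rpow_eq_mul_logb_of_pos hn0, Real.logb_div hn0.ne' hl0.ne']
  field_simp
  ring

lemma exists_abs_hurstEst_sub_le {Ω : Type*} {K : ℕ} (a : Fin (K + 1) → ℝ) (X : ℝ → Ω → ℝ) (H : ℝ)
    {β m : ℝ} (hβ : β ≠ 0) (hm : 0 < m) :
    ∃ L > 0, ∃ δ > 0, ∀ᶠ n in atTop, ∀ ω, |normBetaVar a X H β (n / 2) ω - m| < δ →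
      |normBetaVar a X H β n ω - m| < δ →
      |hurstEst a X β n ω - H| ≤
        L * (|normBetaVar a X H β (n / 2) ω - m| + |normBetaVar a X H β n ω - m|) +
          |H| * (4 * (1 / (n : ℝ))) := by
  obtain ⟨L, hL, δ, hδ, h⟩ := exists_abs_logb_div_le hm
  -- A radius at most `m` keeps both variations positive, so the logarithms split.
  refine ⟨|1 / β| * L, by positivity, min δ m, lt_min hδ hm, ?_⟩
  filter_upwards [eventually_ge_atTop 2] with n hn ω h1 h2
  have h1' := lt_min_iff.1 h1
  have h2' := lt_min_iff.1 h2
  rw [hurstEst_sub_eq hβ hn (by linarith [(abs_lt.1 h1'.2).1]) (by linarith [(abs_lt.1 h2'.2).1])]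
  refine (abs_add_le _ _).trans ?_
  rw [abs_mul, abs_mul, mul_assoc]
  gcongr
  · exact h _ _ h1'.1 h2'.1
  · exact abs_logb_div_half_sub_one_le hn

/-! ### Bounds from the covariance conditions -/

section Estimators

variable {Ω : Type*} [MeasurableSpace Ω] {P : Measure Ω} {X : ℝ → Ω → ℝ} {K : ℕ}
  {a : Fin (K + 1) → ℝ}

lemma measurable_betaVar (hX : ∀ t, Measurable (X t)) (γ : ℝ) (n : ℕ) :
    Measurable (betaVar a X γ n) := by
  have := fun p : ℤ => measurable_genIncr (a := a) hX p n
  unfold betaVar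
  fun_prop

lemma measurable_hurstEst (hX : ∀ t, Measurable (X t)) (γ : ℝ) (n : ℕ) :
    Measurable (hurstEst a X γ n) :=
  (((measurable_betaVar hX γ (n / 2)).div (measurable_betaVar hX γ n)).log.div_const _).const_mul _

lemma measurable_stableEst (hX : ∀ t, Measurable (X t)) {H β₁ β₂ : ℝ} (h₁₂ : β₁ < β₂)
    (h₂ : β₂ < 0) (n : ℕ) : Measurable (stableEst a X H β₁ β₂ n) := by
  have h := fun γ => (measurable_betaVar (a := a) hX γ n).const_mul ((n : ℝ) ^ (γ * H))
  refine (measurable_phiFun (by linarith) (by linarith)).comp ?_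
  exact (((h β₁).log.const_mul _).add ((h β₂).log.const_mul _)).add_const _

/-- Chebyshev bounds for `W_n(γ)` and `W_{n/2}(γ)` in terms of the averaged covariances. -/
lemma eventually_measure_normBetaVar_le {H γ m : ℝ}
    (hW : ∀ n : ℕ, 0 < n → K ≤ n → ∀ r > 0, P {ω | r ≤ |normBetaVar a X H γ n ω - m|} ≤
      ENNReal.ofReal (absCovSum P a X γ n / ((n : ℝ) - K + 1) / r ^ 2)) :
    ∀ᶠ n : ℕ in atTop, ∀ r > 0,
      P {ω | r ≤ |normBetaVar a X H γ n ω - m|} ≤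
        ENNReal.ofReal (6 * (1 / (n : ℝ) * absCovSum P a X γ n) / r ^ 2) ∧
      P {ω | r ≤ |normBetaVar a X H γ (n / 2) ω - m|} ≤
        ENNReal.ofReal (6 * (1 / (n : ℝ) * absCovSum P a X γ n) / r ^ 2) := by
  filter_upwards [eventually_ge_atTop (4 * K + 4)] with n hn r hr
  have hn0 : (0 : ℝ) < n := by exact_mod_cast (by omega : 0 < n)
  -- Both `l = n` and `l = n/2` qualify. The constant `6` comes from `l - K + 1 ≥ l/2` and `l ≥
  -- n/3`.
  have key : ∀ l : ℕ, 2 * K + 1 ≤ l → l ≤ n → n ≤ 3 * l →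
      P {ω | r ≤ |normBetaVar a X H γ l ω - m|} ≤
        ENNReal.ofReal (6 * (1 / (n : ℝ) * absCovSum P a X γ n) / r ^ 2) := by
    intro l hl hln hnl
    refine (hW l (by omega) (by omega) r hr).trans (ENNReal.ofReal_le_ofReal ?_)
    have h1 : (2 : ℝ) * K + 1 ≤ l := by exact_mod_cast hl
    have h2 : (n : ℝ) ≤ 3 * l := by exact_mod_cast hnl
    have h3 : absCovSum P a X γ l ≤ absCovSum P a X γ n := absCovSum_mono γ hln
    have h4 : 0 ≤ absCovSum P a X γ n := absCovSum_nonneg γ n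
    have h5 : (n : ℝ) / 6 ≤ (l : ℝ) - K + 1 := by linarith
    refine div_le_div_of_nonneg_right ?_ (by positivity)
    calc absCovSum P a X γ l / ((l : ℝ) - K + 1) ≤ absCovSum P a X γ n / ((n : ℝ) / 6) := by
          gcongr
      _ = 6 * (1 / (n : ℝ) * absCovSum P a X γ n) := by field_simp
  exact ⟨key n (by omega) le_rfl (by omega), key (n / 2) (by omega) (by omega) (by omega)⟩

lemma AvgCovRate.eventually_le {γ : ℝ} {b : ℕ → ℝ} (h : AvgCovRate P a X γ b) :
    ∃ C > 0, ∀ᶠ n : ℕ in atTop, 1 / (n : ℝ) * absCovSum P a X γ n ≤ C * b n ^ 2 := by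
  obtain ⟨-, hb0, C, hC⟩ := h
  have h1 : ((C ^ 2 : ℝ) : EReal) < ((C ^ 2 + 1 : ℝ) : EReal) :=
    EReal.coe_lt_coe_iff.2 (lt_add_one _)
  refine ⟨C ^ 2 + 1, by positivity, ?_⟩
  filter_upwards [eventually_lt_of_limsup_lt (hC.trans_lt h1), hb0, eventually_gt_atTop 0]
    with n hn hb hn0
  have hn' : (0 : ℝ) < n := by exact_mod_cast hn0
  have hb2 : 0 < b n ^ 2 := by positivity
  have h2 : 1 / ((n : ℝ) * b n ^ 2) * absCovSum P a X γ n < C ^ 2 + 1 := by exact_mod_cast hn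
  rw [one_div_mul_eq_div, div_lt_iff₀ (by positivity)] at h2
  rw [one_div_mul_eq_div, div_le_iff₀ hn']
  linarith

lemma AvgCovRate.avgCovVanishes {γ : ℝ} {b : ℕ → ℝ} (h : AvgCovRate P a X γ b) :
    AvgCovVanishes P a X γ := by
  obtain ⟨C, -, hC⟩ := h.eventually_le
  have h1 : Tendsto (fun n => C * b n ^ 2) atTop (𝓝 0) := by
    simpa using (h.1.pow 2).const_mul C
  exact tendsto_of_tendsto_of_tendsto_of_le_of_le' tendsto_const_nhds h1
    (.of_forall fun n => mul_nonneg (by positivity) (absCovSum_nonneg γ n)) hC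

/-- The rate dominates `1/n`, as the variance of the increments does not vanish. -/
lemma AvgCovRate.eventually_one_div_le {γ w : ℝ} {b : ℕ → ℝ} (h : AvgCovRate P a X γ b)
    (hw : 0 < w) (hS : ∀ n, w ≤ absCovSum P a X γ n) :
    ∃ D > 0, ∀ᶠ n : ℕ in atTop, 1 / (n : ℝ) ≤ D * |b n| := by
  obtain ⟨C, hC0, hC⟩ := h.eventually_le
  refine ⟨C / w, by positivity, ?_⟩
  have hb1 : ∀ᶠ n in atTop, |b n| < 1 := by
    have := h.1.abs
    rw [abs_zero] at this
    exact this.eventually_lt_const one_pos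
  filter_upwards [hC, hb1] with n hn hb
  have h1 : 1 / (n : ℝ) * w ≤ C * |b n| := by
    calc 1 / (n : ℝ) * w ≤ 1 / (n : ℝ) * absCovSum P a X γ n := by gcongr; exact hS n
      _ ≤ C * b n ^ 2 := hn
      _ ≤ C * |b n| := by
        rw [← sq_abs]
        gcongr
        exact pow_le_of_le_one (abs_nonneg _) hb.le two_ne_zero
  rw [div_mul_eq_mul_div, le_div_iff₀ hw]
  exact h1

end Estimators

theorem theorem3p1 {Ω : Type*} [MeasurableSpace Ω] (P : Measure Ω) [IsProbabilityMeasure P]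
    (X : ℝ → Ω → ℝ) (hX : ∀ t, Measurable (X t))
    (H α : ℝ) (hα0 : 0 < α) (hα2 : α ≤ 2)
    (hss : IsSelfSimilar P H X) (hsi : HasStationaryIncr P X) (hstable : IsSaSProcess P α X)
    (K : ℕ) (a : Fin (K + 1) → ℝ)
    (ha0 : ∑ k, a k = 0) (ha1 : ∑ k : Fin (K + 1), ((k : ℕ) : ℝ) * a k = 0)
    (hnd : ¬ ∀ᵐ ω ∂P, genIncr a X 0 1 ω = 0)
    (β β₁ β₂ : ℝ) (hβ : -(1 / 2) < β) (hβ0 : β < 0)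
    (hβ₁ : -(1 / 2) < β₁) (hβ₁₂ : β₁ < β₂) (hβ₂ : β₂ < 0) :
    ((AvgCovVanishes P a X β →
        TendstoInMeasure P (hurstEst a X β) atTop (fun _ => H)) ∧
      (AvgCovVanishes P a X β₁ → AvgCovVanishes P a X β₂ →
        TendstoInMeasure P (stableEst a X H β₁ β₂) atTop (fun _ => α))) ∧
    ∀ b : ℕ → ℝ,
      (AvgCovRate P a X β b →
        TendstoInMeasure P (hurstEst a X β) atTop (fun _ => H) ∧
        IsBigOInProb P (fun n ω => hurstEst a X β n ω - H) b) ∧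
      (AvgCovRate P a X β₁ b → AvgCovRate P a X β₂ b →
        TendstoInMeasure P (stableEst a X H β₁ β₂) atTop (fun _ => α) ∧
        IsBigOInProb P (fun n ω => stableEst a X H β₁ β₂ n ω - α) b) := by
  obtain ⟨σ, hσ, hZ⟩ := isSaS_genIncr hstable hnd
  have hL : ∀ γ : ℝ, -(1 / 2) < γ → γ < 0 → ∀ p : ℤ,
      MemLp (fun ω => |genIncr a X p 1 ω| ^ γ) 2 P := fun γ h1 h2 =>
    memLp_genIncr hX hsi ha0 hα0 hσ h1 h2 hZ
  have hW : ∀ γ : ℝ, -(1 / 2) < γ → γ < 0 → _ := fun γ h1 h2 =>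
    eventually_measure_normBetaVar_le (P := P) (a := a) (X := X) (H := H) (γ := γ)
      (m := sasMoment α σ γ) fun n hn0 hn r hr =>
        measure_le_abs_normBetaVar_sub hss hsi ha0 (hL γ h1 h2)
          (integral_genIncr hX hsi ha0 hα0 hσ (by linarith) h2 hZ) hn0 hn hr
  have hrate : ∀ {γ C C' : ℝ} {b : ℕ → ℝ} {Y : ℕ → Ω → ℝ} {m : ℝ}, C ≤ C' →
      (∀ᶠ n : ℕ in atTop, 1 / (n : ℝ) * absCovSum P a X γ n ≤ C * b n ^ 2) →
      (∀ᶠ n : ℕ in atTop, ∀ r > 0, P {ω | r ≤ |Y n ω - m|} ≤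
        ENNReal.ofReal (6 * (1 / (n : ℝ) * absCovSum P a X γ n) / r ^ 2)) →
      ∀ᶠ n : ℕ in atTop, ∀ r > 0, P {ω | r ≤ |Y n ω - m|} ≤
        ENNReal.ofReal (6 * C' * b n ^ 2 / r ^ 2) := by
    intro γ C C' b Y m hCC hC hY
    filter_upwards [hC, hY] with n hC hY r hr
    refine (hY r hr).trans (ENNReal.ofReal_le_ofReal ?_)
    have : C * b n ^ 2 ≤ C' * b n ^ 2 := by gcongr
    rw [mul_assoc]
    have := hC.trans this
    gcongr 6 * ?_ / _
  have hm := sasMoment_pos hα0 hσ (γ := β) (by linarith) hβ0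
  obtain ⟨L, hL0, δ, hδ, hlip⟩ := exists_abs_hurstEst_sub_le a X H hβ0.ne hm
  obtain ⟨L', hL0', δ', hδ', hlip'⟩ := exists_abs_phiFun_psiFun_sub_le hα0 hσ
    (u := -β₁) (v := -β₂) (by linarith) (by linarith) (by linarith)
  simp only [neg_neg] at hlip'
  have hlip' : ∀ᶠ n in atTop, ∀ ω, |normBetaVar a X H β₁ n ω - sasMoment α σ β₁| < δ' →
      |normBetaVar a X H β₂ n ω - sasMoment α σ β₂| < δ' →
      |stableEst a X H β₁ β₂ n ω - α| ≤ L' * (|normBetaVar a X H β₁ n ω - sasMoment α σ β₁| +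
        |normBetaVar a X H β₂ n ω - sasMoment α σ β₂|) + 0 :=
    .of_forall fun n ω h1 h2 => (hlip' _ _ h1 h2).trans (add_zero _).ge
  have hH : AvgCovVanishes P a X β →
      TendstoInMeasure P (hurstEst a X β) atTop (fun _ => H) := by
    intro h
    refine tendstoInMeasure_of_abs_sub_le hL0 hδ
      ((hW β hβ hβ0).mono fun n hn r hr => (hn r hr).2)
      ((hW β hβ hβ0).mono fun n hn r hr => (hn r hr).1) ?_ ?_ hlip
    · simpa using h.const_mul 6
    · simpa using (tendsto_one_div_atTop_nhds_zero_nat.const_mul 4).const_mul |H|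
  have hα : AvgCovVanishes P a X β₁ → AvgCovVanishes P a X β₂ →
      TendstoInMeasure P (stableEst a X H β₁ β₂) atTop (fun _ => α) := by
    intro h1 h2
    have h1 := h1.const_mul 6
    have h2 := h2.const_mul 6
    -- The sum of the two covariance bounds serves both exponents at once.
    refine tendstoInMeasure_of_abs_sub_le (s := fun n =>
        6 * (1 / (n : ℝ) * absCovSum P a X β₁ n) + 6 * (1 / (n : ℝ) * absCovSum P a X β₂ n))
      hL0' hδ'
      ((hW β₁ hβ₁ (hβ₁₂.trans hβ₂)).mono fun n hn r hr =>
        (hn r hr).1.trans (ENNReal.ofReal_le_ofReal ?_))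
      ((hW β₂ (hβ₁.trans hβ₁₂) hβ₂).mono fun n hn r hr =>
        (hn r hr).1.trans (ENNReal.ofReal_le_ofReal ?_)) ?_ tendsto_const_nhds hlip'
    · have := absCovSum_nonneg (P := P) (a := a) (X := X) β₂ n
      gcongr
      exact le_add_of_nonneg_right (by positivity)
    · have := absCovSum_nonneg (P := P) (a := a) (X := X) β₁ n
      gcongr
      exact le_add_of_nonneg_left (by positivity)
    · simpa using h1.add h2
  refine ⟨⟨hH, hα⟩, fun b => ⟨fun h => ⟨hH h.avgCovVanishes, ?_⟩, fun h1 h2 =>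
    ⟨hα h1.avgCovVanishes h2.avgCovVanishes, ?_⟩⟩⟩
  · obtain ⟨C, hC0, hC⟩ := h.eventually_le
    -- Needed to absorb the rounding error `4|H|/n` into `O(b_n)`.
    obtain ⟨D, hD0, hD⟩ := h.eventually_one_div_le
      (variance_genIncr_pos hX hα0 hσ hβ0 hZ (hL β hβ hβ0 0))
      (variance_le_absCovSum (hL β hβ hβ0))
    refine isBigOInProb_of_abs_sub_le (q := 6 * C) (D := |H| * (4 * D)) hL0 hδ (by positivity)
      (by positivity) (measurable_hurstEst hX β)
      (hrate le_rfl hC ((hW β hβ hβ0).mono fun n hn r hr => (hn r hr).2))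
      (hrate le_rfl hC ((hW β hβ hβ0).mono fun n hn r hr => (hn r hr).1)) h.1 h.2.1 ?_ hlip
    filter_upwards [hD] with n hn
    rw [mul_assoc, mul_assoc]
    gcongr
  · obtain ⟨C₁, hC₁0, hC₁⟩ := h1.eventually_le
    obtain ⟨C₂, hC₂0, hC₂⟩ := h2.eventually_le
    exact isBigOInProb_of_abs_sub_le (q := 6 * (max C₁ C₂)) (D := 0) hL0' hδ'
      (by have := hC₁0.trans_le (le_max_left C₁ C₂); positivity) le_rfl
      (measurable_stableEst hX hβ₁₂ hβ₂)
      (hrate (le_max_left _ _) hC₁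
        ((hW β₁ hβ₁ (hβ₁₂.trans hβ₂)).mono fun n hn r hr => (hn r hr).1))
      (hrate (le_max_right _ _) hC₂
        ((hW β₂ (hβ₁.trans hβ₁₂) hβ₂).mono fun n hn r hr => (hn r hr).1))
      h1.1 h1.2.1 (.of_forall fun n => (zero_mul _).ge) hlip'

end
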